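/- **Setting.** Let $N, m, T \ge 1$ be integers with $mN > 4$, and let $\mathcal S \subseteq \{0,1\}^N$ be a nonempty action set with $\|\mathbf v\|_1 \le m$ for all $\mathbf v \in \mathcal S$. In each round $t = 1, \dots, T$ the environment picks a loss vector $\boldsymbol\ell_t \in [0,1]^N$ and a directed graph $\mathcal G_t$ on $[N]$; both may depend on the learner's earlier actions $\mathbf V_1, \dots, \mathbf V_{t-1}$. The learner picks $\mathbf V_t \in \mathcal S$, incurs the loss $\mathbf V_t^{\mathsf T} \boldsymbol\ell_t$, and observes $\ell_{t,i}$ for every $i$ with $O_{t,i} = 1$, where $O_{t,i} = 1$ if $V_{t,i} = 1$ or $V_{t,j} = 1$ for some edge $(j \to i) \in \mathcal G_t$, and $O_{t,i} = 0$ otherwise. The regret is $$R_T = \max_{\mathbf v \in \mathcal S} \mathbb E\Big[\sum_{t=1}^T (\mathbf V_t - \mathbf v)^{\mathsf T} \boldsymbol\ell_t\Big].$$ Let $\alpha_t$ be the independence number of $\mathcal G_t$ (the maximal number of nodes with no edge in either direction between two distinct ones), let $C > 1$, and let $\widetilde\alpha_t$ be real numbers, determined by $\mathbf V_1, \dots,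 \mathbf V_{t-1}$, with $\alpha_t / C \le \widetilde\alpha_t \le \alpha_t$. **FPL-IX.** In round $t$ the learner uses $$\eta_t = \gamma_t = \sqrt{\frac{\log N + 1}{m\,\big(N + \sum_{s=1}^{t-1} \widetilde\alpha_s\big)}}, \qquad \mathbf V_t = \operatorname*{arg\,min}_{\mathbf v \in \mathcal S} \mathbf v^{\mathsf T}\big(\eta_t \widehat{\mathbf L}_{t-1} - \mathbf Z_t\big), \qquad \widehat{\mathbf L}_{t-1} = \sum_{s=1}^{t-1} \hat{\boldsymbol\ell}_s,$$ where $\mathbf Z_t$ has independent exponential components with expectation $1$. The loss estimates are $\hat\ell_{t,i} = K_{t,i}\, O_{t,i}\, \ell_{t,i}$ with $$K_{t,i} = \min\big(\{k \ge 1 : O'_{t,i}(k) = 1\} \cup \{U_{t,i}\}\big),$$ where, conditionally on the past, $\boldsymbol O'_t(1), \boldsymbol O'_t(2), \dots$ are the observation indicators of independent copies of $\mathbf V_t$ (computed by the same rule with fresh independent perturbations), and the $U_{t,i} \in \{1, 2, \dots\}$ are independent geometric variables with parameter $\gamma_t$, all independent of each other and of $\mathbf Z_t$. **Theorem (Regret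 of FPL-IX).** There is a function $H = H(N,m,T)$ with $H = \mathcal O(\log(mNT))$ (that is, $|H| \le c \log(mNT)$ with a universal constant $c$, for all $m, N, T \ge 1$ with $mN > 4$) such that in every such setting FPL-IX satisfies $$R_T \le H\, m^{3/2}\, \mathbb E\left[\sqrt{\Big(N + C \sum_{t=1}^T \alpha_t\Big)(\log N + 1)}\,\right].$$ In particular, if the independence numbers $\alpha_1, \dots, \alpha_T$ do not depend on the actions played (for instance if the graphs are fixed in advance), then $$R_T \le H\, m^{3/2} \sqrt{\Big(N + C \sum_{t=1}^T \alpha_t\Big)(\log N + 1)}.$$ -/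

import Mathlib

open MeasureTheory ProbabilityTheory

namespace FPLIX

noncomputable section

/-- An action, i.e. a binary vector in `{0,1}^N`, given by the set of its nonzero components. -/
abbrev Action (N : ℕ) := Finset (Fin N)

/-- The inner product `vᵀ x` of the binary vector `v` with `x ∈ ℝ^N`. -/
def dot {N : ℕ} (v : Action N) (x : Fin N → ℝ) : ℝ := ∑ i ∈ v, x i

/-- The environment. In every round it picks a loss vector and a directed observability graph,
possibly depending on the actions that the learner played in the earlier rounds (listed with
the most recent action first, so that the list before round `t` has length `t - 1`).
An environment whose choices are fixed in advance is one that only uses the length of the list. -/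
structure Environment (N : ℕ) where
  /-- the loss vector of the next round -/
  loss : List (Action N) → Fin N → ℝ
  /-- the observability graph of the next round -/
  graph : List (Action N) → Digraph (Fin N)

/-- The independence number of a directed graph: the maximal size of a set of nodes no two of
which are joined by an edge (in either direction). -/
def indepNumber {N : ℕ} (G : Digraph (Fin N)) : ℕ := G.toSimpleGraphInclusive.indepNum

/-- Component `i` is observed when `v` is played: it is a component of `v` itself,
or there is an edge to it from a component of `v`. -/
def Observed {N : ℕ} (G : Digraph (Fin N)) (v : Action N) (i : Fin N) : Prop :=
  i ∈ v ∨ ∃ j ∈ v, G.Adj j i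

/-- What the learner produces in one round: the action `V_t` that is played,
and the vector `K_t` of geometric resampling counts. -/
structure Round (N : ℕ) where
  /-- the action `V_t` -/
  action : Action N
  /-- the counts `K_{t,i}` -/
  resample : Fin N → ℕ

instance (N : ℕ) : MeasurableSpace (Round N) := ⊤

/-- Histories (most recent round first) form a countable set, with the discrete σ-algebra. -/
instance (N : ℕ) : MeasurableSpace (List (Round N)) := ⊤

/-- The actions played along a history. -/
def actions {N : ℕ} (h : List (Round N)) : List (Action N) := h.map Round.action

/-- `sumPast f a` is `f₁ + ⋯ + f_n`, where `n` is the length of `a` and where `f_s` is the value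
of `f` at the actions played before round `s`. -/
def sumPast {N : ℕ} (f : List (Action N) → ℝ) : List (Action N) → ℝ
  | [] => 0
  | _ :: a => sumPast f a + f a

open Classical in
/-- The cumulative loss estimates: the sum over the rounds `s` of the history of
`K_{s,i} O_{s,i} ℓ_{s,i}`, where `O_{s,i}` is the indicator that `i` is observed in round `s`. -/
def lossEstimate {N : ℕ} (E : Environment N) : List (Round N) → Fin N → ℝ
  | [], _ => 0
  | r :: h, i => lossEstimate E h i +
      (r.resample i : ℝ) * (if Observed (E.graph (actions h)) r.action i then 1 else 0) *
        E.loss (actions h) i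

/-- The parameter `η_t = γ_t = √((log N + 1) / (m (N + ∑_{s < t} α̃_s)))`, where `approx` gives the
approximate independence numbers `α̃_s`, and `a` lists the actions played before round `t`. -/
def rate {N : ℕ} (m : ℕ) (approx : List (Action N) → ℝ) (a : List (Action N)) : ℝ :=
  Real.sqrt ((Real.log N + 1) / (m * (N + sumPast approx a)))

/-- The optimization oracle: a minimizer of `vᵀ x` over `v ∈ S`
(ties, which have probability zero in the algorithm, are broken by a fixed order of `S`). -/
def leader {N : ℕ} (S : Finset (Action N)) (x : Fin N → ℝ) : Action N :=
  (S.toList.argmin (fun v => dot v x)).getD ∅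

/-- The law of a perturbation vector: independent exponential components of unit expectation. -/
def perturbationLaw (N : ℕ) : Measure (Fin N → ℝ) := Measure.pi fun _ => expMeasure 1

instance (N : ℕ) : IsProbabilityMeasure (perturbationLaw N) := by
  have : IsProbabilityMeasure (expMeasure 1) := isProbabilityMeasure_expMeasure one_pos
  unfold perturbationLaw
  infer_instance

/-- The randomness of one round: independent perturbation vectors `z 0, z 1, z 2, …` and,
independently of them, independent geometric variables with parameter `γ ∈ (0, 1]`, one for each
component, which count the failures before the first success. -/
def noiseLaw (N : ℕ) (γ : ℝ) : Measure ((ℕ → Fin N → ℝ) × (Fin N → ℕ)) :=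
  (Measure.infinitePi fun _ : ℕ => perturbationLaw N).prod
    (Measure.pi fun _ : Fin N => geometricMeasure (Set.projIcc 0 1 zero_le_one γ))

/-- The follow-the-perturbed-leader rule `argmin_{v ∈ S} vᵀ (η L - z)`. -/
def perturbedLeader {N : ℕ} (S : Finset (Action N)) (η : ℝ) (L z : Fin N → ℝ) : Action N :=
  leader S (fun i => η * L i - z i)

/-- One round of FPL-IX, from the noise `ω` of the round. The action played uses the perturbation
`z 0`; the copies number `k = 1, 2, …` of it use `z k`, and
`K_i = min ({k ≥ 1 : copy k observes i} ∪ {U_i})`, where `U_i ∈ {1, 2, …}` is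
geometric with parameter `γ` (the failure count plus one). -/
def playRound {N : ℕ} (S : Finset (Action N)) (G : Digraph (Fin N)) (η : ℝ) (L : Fin N → ℝ)
    (ω : (ℕ → Fin N → ℝ) × (Fin N → ℕ)) : Round N where
  action := perturbedLeader S η L (ω.1 0)
  resample := fun i =>
    sInf ({k : ℕ | 1 ≤ k ∧ Observed G (perturbedLeader S η L (ω.1 k)) i} ∪ {ω.2 i + 1})

/-- The conditional law of the next round of FPL-IX, given the history. -/
def roundLaw {N : ℕ} (m : ℕ) (S : Finset (Action N)) (E : Environment N)
    (approx : List (Action N) → ℝ) (h : List (Round N)) : Measure (Round N) :=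
  (noiseLaw N (rate m approx (actions h))).map
    (playRound S (E.graph (actions h)) (rate m approx (actions h)) (lossEstimate E h))

/-- The law of the history of the first `t` rounds when FPL-IX plays against `E`. -/
def historyLaw {N : ℕ} (m : ℕ) (S : Finset (Action N)) (E : Environment N)
    (approx : List (Action N) → ℝ) : ℕ → Measure (List (Round N))
  | 0 => Measure.dirac []
  | t + 1 => (historyLaw m S E approx t).bind fun h =>
      (roundLaw m S E approx h).map fun r => r :: h

/-- `∑_t (V_t - v)ᵀ ℓ_t` along the sequence of played actions `V_t`. -/
def excessLoss {N : ℕ} (E : Environment N) (v : Action N) : List (Action N) → ℝ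
  | [] => 0
  | u :: a => excessLoss E v a + (dot u (E.loss a) - dot v (E.loss a))

/-- The regret `R_T = max_{v ∈ S} 𝔼[∑_{t ≤ T} (V_t - v)ᵀ ℓ_t]` of FPL-IX. -/
def regret {N : ℕ} (m : ℕ) (S : Finset (Action N)) (hS : S.Nonempty) (E : Environment N)
    (approx : List (Action N) → ℝ) (T : ℕ) : ℝ :=
  S.sup' hS fun v => ∫ h, excessLoss E v (actions h) ∂(historyLaw m S E approx T)

end

end FPLIX

/-! Fix a comparator `v`. Its regret splits into a part that treats the loss estimates as true
losses, bounded along every history, and an estimation error, bounded in conditional expectation.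

Pathwise part (`cumulative_estimatedGap_le`): let Φ_η(L) = E min_u uᵀ(L - Z/η) be the `potential`,
and p_u the probability that u is played. Since exponential variables are memoryless, adding an
estimate x to L multiplies p_u by at least exp(-η uᵀx), so Φ_η grows by at least ∑_u p_u (uᵀx - η
(uᵀx)²). Lowering η to η' costs at most (1/η' - 1/η) m (log N + 1), because the expected maximum of
N exponentials is at most log N + 1. These costs telescope to m (log N + 1)/η for the final η.

Estimation error (`integral_regretIncrement_le`): if o_i is the probability of observing i, then K_i
is geometric with parameter ρ_i = 1 - (1 - o_i)(1 - η), which is at least o_i and at least η. The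
estimate has mean (o_i/ρ_i) ℓ_i, hence never overestimates and has bias at most η/ρ_i; its second
moment is at most 2/ρ_i. With q_i the probability of playing i, one round costs at most (2m + 1) η ∑
q_i/ρ_i.

Graph part (`sum_playProb_div_resampleRate_le`): a weighted Turán theorem yields ∑ q_i/ρ_i ≤ 4 m α
log(1 + 1/η), and 1/η ≤ mNT up to round T. Finally ∑ η_t α_t is of the order of a square root
(`sumPast_rate_mul_le`), and the compensated increments are summed by the tower property
(`integrable_cumulative`). -/

namespace FPLIX

/-! ### Weighted Turán bounds and independence numbers -/

open Classical in
/-- A weighted form of Turán's theorem: the closed neighbourhood weights are large on average. -/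
theorem exists_indepSet_sq_sum_le {V : Type*} (H : SimpleGraph V) (w : V → ℝ)
    (hw : ∀ i, 0 ≤ w i) (A : Finset V) :
    ∃ I : Finset V, I ⊆ A ∧ H.IsIndepSet (I : Set V) ∧
      (∑ i ∈ A, w i) ^ 2 ≤ I.card * ∑ i ∈ A, w i * ∑ j ∈ A with j = i ∨ H.Adj i j, w j := by
  induction A using Finset.strongInduction with
  | H A ih =>
  rcases A.eq_empty_or_nonempty with rfl | hA
  · exact ⟨∅, by simp⟩
  -- Greedy choice: take `v` with the lightest closed neighbourhood, delete that neighbourhood, and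
  -- recurse on the rest `B`.
  obtain ⟨v, hv, hmin⟩ := A.exists_min_image
    (fun i => ∑ j ∈ A with j = i ∨ H.Adj i j, w j) hA
  set P := A.filter (fun j => j = v ∨ H.Adj v j) with hP
  set B := A.filter (fun j => ¬ (j = v ∨ H.Adj v j)) with hB
  have hBA : B ⊂ A := by
    refine Finset.ssubset_iff_subset_ne.2 ⟨Finset.filter_subset _ _, fun h => ?_⟩
    have : v ∈ B := h ▸ hv
    simp [hB] at this
  obtain ⟨I, hIB, hI, hle⟩ := ih B hBA
  have hvI : v ∉ I := fun h => by
    have := hIB h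
    simp [hB] at this
  refine ⟨insert v I, ?_, ?_, ?_⟩
  · exact Finset.insert_subset hv (hIB.trans hBA.1)
  · rw [Finset.coe_insert]
    refine Set.pairwise_insert.2 ⟨hI, fun b hb _ => ?_⟩
    have := hIB hb
    simp only [hB, Finset.mem_filter, not_or] at this
    exact ⟨this.2.2, fun h => this.2.2 h.symm⟩
  · rw [Finset.card_insert_of_notMem hvI]
    set W := ∑ j ∈ P, w j with hW
    have hW0 : 0 ≤ W := Finset.sum_nonneg fun i _ => hw i
    set X := ∑ i ∈ B, w i * ∑ j ∈ B with j = i ∨ H.Adj i j, w j with hX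
    have hX0 : 0 ≤ X := Finset.sum_nonneg fun i _ =>
      mul_nonneg (hw i) (Finset.sum_nonneg fun i _ => hw i)
    have h1 : ∑ i ∈ A, w i = W + ∑ i ∈ B, w i := (Finset.sum_filter_add_sum_filter_not _ _ _).symm
    have h2 : W * W + X ≤ ∑ i ∈ A, w i * ∑ j ∈ A with j = i ∨ H.Adj i j, w j := by
      rw [← Finset.sum_filter_add_sum_filter_not A (fun j => j = v ∨ H.Adj v j)]
      refine add_le_add ?_ ?_
      · rw [hW, Finset.sum_mul]
        refine Finset.sum_le_sum fun i hi => mul_le_mul_of_nonneg_left ?_ (hw i)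
        exact hmin i (Finset.mem_filter.1 hi).1
      · refine Finset.sum_le_sum fun i hi => mul_le_mul_of_nonneg_left ?_ (hw i)
        refine Finset.sum_le_sum_of_subset_of_nonneg ?_ fun i _ _ => hw i
        exact Finset.filter_subset_filter _ hBA.1
    set b := ∑ i ∈ B, w i
    have hb0 : 0 ≤ b := Finset.sum_nonneg fun i _ => hw i
    rw [h1]
    push_cast
    refine le_trans ?_ (mul_le_mul_of_nonneg_left h2 (by positivity))
    set r : ℝ := (I.card : ℝ)
    have hr : 0 ≤ r := Nat.cast_nonneg _
    -- AM-GM: the induction hypothesis b² ≤ rX gives (2Wb)² ≤ 4 (rW²) X ≤ (rW² + X)². This is the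
    -- cross term needed for (W + b)² ≤ (r + 1)(W² + X).
    have key : 2 * W * b ≤ r * W ^ 2 + X := by
      refine abs_le_of_sq_le_sq' ?_ (by positivity) |>.2
      nlinarith [sq_nonneg (r * W ^ 2 - X), mul_le_mul_of_nonneg_left hle (sq_nonneg W)]
    nlinarith

open Classical in
/-- The weight of the closed in-neighbourhood of `i` in the subgraph induced by `A`. -/
noncomputable def inWeight {N : ℕ} (G : Digraph (Fin N)) (w : Fin N → ℝ) (A : Finset (Fin N))
    (i : Fin N) : ℝ := ∑ j ∈ A with j = i ∨ G.Adj j i, w j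

theorem inWeight_nonneg {N : ℕ} (G : Digraph (Fin N)) {w : Fin N → ℝ} (hw : ∀ i, 0 ≤ w i)
    (A : Finset (Fin N)) (i : Fin N) : 0 ≤ inWeight G w A i :=
  Finset.sum_nonneg fun i _ => hw i

/-- By averaging: were every in-weight too small, its `w`-weighted mean would contradict the Turán
bound for the symmetrised graph. -/
theorem exists_sum_le_inWeight {N : ℕ} (G : Digraph (Fin N)) {w : Fin N → ℝ} (hw : ∀ i, 0 ≤ w i)
    {A : Finset (Fin N)} (hA : A.Nonempty) :
    ∃ i ∈ A, ∑ j ∈ A, w j ≤ 2 * indepNumber G * inWeight G w A i := by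
  classical
  by_contra! hcon
  obtain ⟨I, -, hI, hle⟩ := exists_indepSet_sq_sum_le G.toSimpleGraphInclusive w hw A
  have hcard : (I.card : ℝ) ≤ indepNumber G := by
    exact_mod_cast hI.card_le_indepNum
  set s := ∑ j ∈ A, w j with hs
  have hspos : 0 < s := by
    obtain ⟨i, hi⟩ := hA
    exact lt_of_le_of_lt (by have := inWeight_nonneg G hw A i; positivity) (hcon i hi)
  obtain ⟨i₀, hi₀, hwi₀⟩ : ∃ i ∈ A, 0 < w i := by
    by_contra! h
    exact hspos.not_ge (Finset.sum_nonpos h)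
  -- The in-weight sum, written once as is and once with `i` and `j` exchanged, covers every
  -- undirected edge whichever way its arc points; hence the factor 2.
  have h1 : ∑ i ∈ A, w i * ∑ j ∈ A with j = i ∨ G.toSimpleGraphInclusive.Adj i j, w j
      ≤ 2 * ∑ i ∈ A, w i * inWeight G w A i := by
    have e1 : ∑ i ∈ A, w i * inWeight G w A i
        = ∑ i ∈ A, ∑ j ∈ A, w i * (if j = i ∨ G.Adj j i then w j else 0) := by
      simp only [inWeight, Finset.sum_filter, Finset.mul_sum]
    have e2 : ∑ i ∈ A, w i * inWeight G w A i
        = ∑ i ∈ A, ∑ j ∈ A, w i * (if i = j ∨ G.Adj i j then w j else 0) := by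
      rw [e1, Finset.sum_comm]
      refine Finset.sum_congr rfl fun i _ => Finset.sum_congr rfl fun j _ => ?_
      split_ifs <;> ring
    rw [two_mul]
    nth_rewrite 1 [e1]
    rw [e2, ← Finset.sum_add_distrib]
    refine Finset.sum_le_sum fun i _ => ?_
    rw [← Finset.sum_add_distrib, Finset.sum_filter, Finset.mul_sum]
    refine Finset.sum_le_sum fun j _ => ?_
    rw [← mul_add]
    refine mul_le_mul_of_nonneg_left ?_ (hw i)
    have := hw j
    simp only [Digraph.toSimpleGraphInclusive, SimpleGraph.fromRel_adj]
    split_ifs <;> first | linarith | (exfalso; tauto)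
  have h2 : ∑ i ∈ A, w i * (2 * indepNumber G * inWeight G w A i) < ∑ i ∈ A, w i * s :=
    Finset.sum_lt_sum (fun i hi => mul_le_mul_of_nonneg_left (hcon i hi).le (hw i))
      ⟨i₀, hi₀, mul_lt_mul_of_pos_left (hcon i₀ hi₀) hwi₀⟩
  rw [← Finset.sum_mul, ← hs] at h2
  have h3 : ∑ i ∈ A, w i * (2 * indepNumber G * inWeight G w A i)
      = indepNumber G * (2 * ∑ i ∈ A, w i * inWeight G w A i) := by
    rw [Finset.mul_sum, Finset.mul_sum]
    exact Finset.sum_congr rfl fun i _ => by ring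
  have h4 := mul_le_mul hcard h1 (Finset.sum_nonneg fun i _ =>
      mul_nonneg (hw i) (Finset.sum_nonneg fun i _ => hw i)) (Nat.cast_nonneg _)
  exact ((hle.trans (by convert h4)).trans_lt (h3 ▸ h2)).ne (sq s)

/-- Peel off a vertex of in-weight at least s/a, where s is the current total weight and a = 2α. Its
term is at most w_i/(c + s/a), which `1 - 1/x ≤ log x` bounds by the decrease of the logarithm; the
other denominators only shrink when it is removed. -/
theorem sum_div_inWeight_le {N : ℕ} (G : Digraph (Fin N)) {w : Fin N → ℝ} (hw : ∀ i, 0 ≤ w i)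
    {c : ℝ} (hc : 0 < c) (hα : 1 ≤ indepNumber G) (A : Finset (Fin N)) :
    ∑ i ∈ A, w i / (c + inWeight G w A i) ≤
      2 * indepNumber G * Real.log (1 + (∑ i ∈ A, w i) / (2 * indepNumber G * c)) := by
  classical
  have hα' : (0 : ℝ) < 2 * indepNumber G := by
    have : (1 : ℝ) ≤ indepNumber G := by exact_mod_cast hα
    linarith
  set a : ℝ := 2 * indepNumber G with ha
  induction A using Finset.strongInduction with
  | H A ih =>
  rcases A.eq_empty_or_nonempty with rfl | hA
  · simp
  obtain ⟨i, hi, hle⟩ := exists_sum_le_inWeight G hw hA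
  have hI := ih (A.erase i) (Finset.erase_ssubset hi)
  set s := ∑ j ∈ A, w j with hs
  set s' := ∑ j ∈ A.erase i, w j with hs'
  have hss' : s = w i + s' := (Finset.add_sum_erase A w hi).symm
  have hs0 : 0 ≤ s' := Finset.sum_nonneg fun i _ => hw i
  rw [← Finset.add_sum_erase _ _ hi]
  have h1 : ∑ j ∈ A.erase i, w j / (c + inWeight G w A j) ≤
      ∑ j ∈ A.erase i, w j / (c + inWeight G w (A.erase i) j) := by
    refine Finset.sum_le_sum fun j _ => ?_
    have := inWeight_nonneg G hw (A.erase i) j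
    refine div_le_div_of_nonneg_left (hw j) (by positivity) ?_
    refine add_le_add le_rfl (Finset.sum_le_sum_of_subset_of_nonneg ?_ fun i _ _ => hw i)
    exact Finset.filter_subset_filter _ (Finset.erase_subset _ _)
  have hwi := hw i
  have hs1 : 0 ≤ s := by rw [hss']; positivity
  have h2 : w i / (c + inWeight G w A i) ≤ w i / (c + s / a) := by
    refine div_le_div_of_nonneg_left (hw i) (by positivity) ?_
    have : s / a ≤ inWeight G w A i := by
      rw [div_le_iff₀ hα']; linarith
    linarith
  have hx : 0 < 1 + s' / (a * c) := by positivity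
  have hy : 0 < 1 + s / (a * c) := by positivity
  have h3 : w i / (c + s / a) ≤
      a * (Real.log (1 + s / (a * c)) - Real.log (1 + s' / (a * c))) := by
    rw [← Real.log_div hy.ne' hx.ne']
    have := Real.one_sub_inv_le_log_of_pos (div_pos hy hx)
    refine le_trans (le_of_eq ?_) (mul_le_mul_of_nonneg_left this hα'.le)
    rw [inv_div]
    have : s' = s - w i := by linarith
    rw [this]
    have h5 : c * a + s ≠ 0 := by positivity
    field_simp
    ring
  linarith

/-! ### The optimization oracle: monotonicity and measurability -/

section Leader

variable {N : ℕ} {S : Finset (Action N)}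

-- Spelling out the tie-breaking makes the event of choosing `u` a finite combination of linear
-- inequalities. Measurability and monotonicity then hold exactly, with no appeal to ties being
-- null.
open Classical in
theorem leader_eq_iff (hS : S.Nonempty) (x : Fin N → ℝ) (u : Action N) :
    leader S x = u ↔ u ∈ S ∧ (∀ v ∈ S, dot u x ≤ dot v x) ∧
      ∀ v ∈ S, dot v x ≤ dot u x → S.toList.idxOf u ≤ S.toList.idxOf v := by
  have h := List.mem_argmin_iff (f := fun v => dot v x) (l := S.toList) (m := u)
  simp only [Finset.mem_toList] at h
  rw [← h, leader]
  cases hm : S.toList.argmin (fun v => dot v x) with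
  | none => simp [List.argmin_eq_none, hS.ne_empty] at hm
  | some a => simp [Option.mem_def]

theorem leader_mem (hS : S.Nonempty) (x : Fin N → ℝ) : leader S x ∈ S :=
  ((leader_eq_iff hS x _).1 rfl).1

theorem dot_leader_le (hS : S.Nonempty) (x : Fin N → ℝ) {v : Action N} (hv : v ∈ S) :
    dot (leader S x) x ≤ dot v x :=
  ((leader_eq_iff hS x _).1 rfl).2.1 v hv

theorem leader_eq_of_le (hS : S.Nonempty) {x y : Fin N → ℝ} {u : Action N}
    (h : leader S x = u) (hxy : ∀ i, x i ≤ y i) (hu : ∀ i ∈ u, x i = y i) :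
    leader S y = u := by
  rw [leader_eq_iff hS] at h ⊢
  have e : dot u y = dot u x := Finset.sum_congr rfl fun i hi => (hu i hi).symm
  have m : ∀ v, dot v x ≤ dot v y := fun v => Finset.sum_le_sum fun i _ => hxy i
  rw [e]
  exact ⟨h.1, fun v hv => (h.2.1 v hv).trans (m v), fun v hv hle => h.2.2 v hv ((m v).trans hle)⟩

@[fun_prop]
theorem measurable_dot (v : Action N) : Measurable (dot v) := by
  unfold dot
  exact Finset.measurable_sum _ fun i _ => measurable_pi_apply i

theorem measurableSet_leader_eq (hS : S.Nonempty) (u : Action N) :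
    MeasurableSet {x | leader S x = u} := by
  classical
  have : {x | leader S x = u} = {x | u ∈ S} ∩ ((⋂ v ∈ S, {x | dot u x ≤ dot v x}) ∩
      ⋂ v ∈ S, ({x | dot v x ≤ dot u x}ᶜ ∪ {_x | S.toList.idxOf u ≤ S.toList.idxOf v})) := by
    ext x
    simp only [Set.mem_ofPred_eq, leader_eq_iff hS, Set.mem_inter_iff, Set.mem_iInter,
      Set.mem_union, Set.mem_compl_iff, ← imp_iff_not_or]
  rw [this]
  refine (MeasurableSet.const _).inter (MeasurableSet.inter ?_ ?_)
  · exact S.measurableSet_biInter fun v _ => measurableSet_le (measurable_dot u) (measurable_dot v)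
  · exact S.measurableSet_biInter fun v _ =>
      (measurableSet_le (measurable_dot v) (measurable_dot u)).compl.union (MeasurableSet.const _)

theorem measurableSet_perturbedLeader_eq (hS : S.Nonempty) (η : ℝ) (L : Fin N → ℝ)
    (u : Action N) : MeasurableSet {z | perturbedLeader S η L z = u} :=
  (measurableSet_leader_eq hS u).preimage (f := fun (z : Fin N → ℝ) i => η * L i - z i)
    (by fun_prop)

theorem measurableSet_perturbedLeader (hS : S.Nonempty) (η : ℝ) (L : Fin N → ℝ)
    (p : Action N → Prop) : MeasurableSet {z | p (perturbedLeader S η L z)} := by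
  have : {z | p (perturbedLeader S η L z)} =
      ⋃ u ∈ {u | p u}, {z | perturbedLeader S η L z = u} := by
    ext z; simp
  rw [this]
  exact MeasurableSet.biUnion (Set.to_countable _) fun u _ => measurableSet_perturbedLeader_eq hS η L u

end Leader

/-! ### Exponential perturbations -/

section Perturbation

/-- Memorylessness: on [y, ∞) the density factors as exp(-y) times the shifted density. -/
theorem expMeasure_shift {y : ℝ} (hy : 0 ≤ y) {s : Set ℝ} (hs : MeasurableSet s) :
    expMeasure 1 {z | z - y ∈ s ∧ y ≤ z} = ENNReal.ofReal (Real.exp (-y)) * expMeasure 1 s := by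
  have hms : MeasurableSet {z : ℝ | z - y ∈ s ∧ y ≤ z} :=
    (hs.preimage (f := fun z : ℝ => z - y) (by fun_prop)).inter measurableSet_Ici
  have e : expMeasure 1 = volume.withDensity (exponentialPDF 1) := rfl
  rw [e, withDensity_apply _ hms, withDensity_apply _ hs, ← lintegral_indicator hms,
    ← lintegral_indicator hs,
    ← lintegral_add_right_eq_self _ y, ← lintegral_const_mul' _ _ ENNReal.ofReal_ne_top]
  refine lintegral_congr fun x => ?_
  classical
  simp only [Set.indicator_apply, Set.mem_ofPred_eq, add_sub_cancel_right, le_add_iff_nonneg_left]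
  by_cases hx : 0 ≤ x
  · by_cases hxs : x ∈ s
    · simp only [hx, hxs, and_self, if_true, exponentialPDF_of_nonneg hx,
        exponentialPDF_of_nonneg (add_nonneg hx hy)]
      rw [← ENNReal.ofReal_mul (Real.exp_nonneg _)]
      congr 1
      rw [one_mul, one_mul, one_mul, one_mul, ← Real.exp_add]
      ring_nf
    · simp [hxs]
  · simp [hx, exponentialPDF_of_neg (not_le.1 hx)]

instance : IsProbabilityMeasure (expMeasure 1) := isProbabilityMeasure_expMeasure one_pos

theorem expMeasure_map_sub {y : ℝ} (hy : 0 ≤ y) :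
    ((expMeasure 1).restrict (Set.Ici y)).map (fun z => z - y) =
      ENNReal.ofReal (Real.exp (-y)) • expMeasure 1 := by
  ext s hs
  rw [Measure.map_apply (by fun_prop) hs,
    Measure.restrict_apply (hs.preimage (f := fun z : ℝ => z - y) (by fun_prop)),
    Measure.smul_apply, smul_eq_mul, ← expMeasure_shift hy hs]
  rfl

variable {N : ℕ}

theorem perturbationLaw_map_sub {y : Fin N → ℝ} (hy : ∀ i, 0 ≤ y i) :
    ((perturbationLaw N).restrict (Set.univ.pi fun i => Set.Ici (y i))).map (fun z i => z i - y i) =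
      ENNReal.ofReal (Real.exp (-∑ i, y i)) • perturbationLaw N := by
  have hc : ENNReal.ofReal (Real.exp (∑ i, y i)) * ENNReal.ofReal (Real.exp (-∑ i, y i)) = 1 := by
    rw [← ENNReal.ofReal_mul (Real.exp_nonneg _), ← Real.exp_add]; simp
  -- The factor is moved to the left so that uniqueness of the product measure can be applied on
  -- boxes.
  suffices h : ENNReal.ofReal (Real.exp (∑ i, y i)) •
      ((perturbationLaw N).restrict (Set.univ.pi fun i => Set.Ici (y i))).map
        (fun z i => z i - y i) = perturbationLaw N by
    conv_rhs => rw [← h]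
    rw [smul_smul, mul_comm, hc, one_smul]
  refine (Measure.pi_eq fun s hs => ?_).symm
  have hms : MeasurableSet (Set.univ.pi s) := MeasurableSet.univ_pi hs
  have hm : Measurable fun (z : Fin N → ℝ) i => z i - y i := by fun_prop
  rw [Measure.smul_apply, smul_eq_mul, Measure.map_apply hm hms, Measure.restrict_apply (hm hms)]
  have e : (fun (z : Fin N → ℝ) i => z i - y i) ⁻¹' Set.univ.pi s ∩
      Set.univ.pi (fun i => Set.Ici (y i)) =
      Set.univ.pi fun i => {z | z - y i ∈ s i ∧ y i ≤ z} := by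
    ext z
    simp only [Set.mem_inter_iff, Set.mem_preimage, Set.mem_univ_pi, Set.mem_Ici,
      Set.mem_ofPred_eq, forall_and]
  rw [e, perturbationLaw, Measure.pi_pi]
  simp_rw [expMeasure_shift (hy _) (hs _)]
  rw [Finset.prod_mul_distrib, ← ENNReal.ofReal_prod_of_nonneg fun i _ => Real.exp_nonneg _,
    ← Real.exp_sum, Finset.sum_neg_distrib, ← mul_assoc, hc, one_mul]

/-- Shifting the perturbations changes probabilities by at most an exponential factor. -/
theorem exp_neg_mul_perturbationLaw_le {y : Fin N → ℝ} (hy : ∀ i, 0 ≤ y i)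
    {s : Set (Fin N → ℝ)} (hs : MeasurableSet s) :
    Real.exp (-∑ i, y i) * (perturbationLaw N).real s ≤
      (perturbationLaw N).real {z | (fun i => z i - y i) ∈ s} := by
  have hm : Measurable fun (z : Fin N → ℝ) i => z i - y i := by fun_prop
  have h := congrArg (fun μ => μ s) (perturbationLaw_map_sub hy)
  simp only [Measure.smul_apply, smul_eq_mul, Measure.map_apply hm hs,
    Measure.restrict_apply (hm hs)] at h
  have h2 : ENNReal.ofReal (Real.exp (-∑ i, y i)) * perturbationLaw N s ≤
      perturbationLaw N {z | (fun i => z i - y i) ∈ s} :=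
    h ▸ measure_mono Set.inter_subset_left
  have h3 := ENNReal.toReal_mono (measure_ne_top _ _) h2
  rwa [ENNReal.toReal_mul, ENNReal.toReal_ofReal (Real.exp_nonneg _)] at h3

theorem lintegral_expMeasure_id : ∫⁻ z, ENNReal.ofReal z ∂(expMeasure 1) = 1 := by
  have e : expMeasure 1 = volume.withDensity (exponentialPDF 1) := rfl
  have hm : Measurable (exponentialPDF 1) := by
    unfold exponentialPDF; fun_prop
  rw [e, lintegral_withDensity_eq_lintegral_mul _ hm (by fun_prop),
    -- The integrand z exp(-z) is the Gamma(2, 1) density.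
    ← lintegral_gammaPDF_eq_one (a := 2) (r := 1) two_pos one_pos]
  refine lintegral_congr fun x => ?_
  by_cases hx : 0 ≤ x
  · rw [Pi.mul_apply, exponentialPDF_of_nonneg hx, gammaPDF_of_nonneg hx,
      ← ENNReal.ofReal_mul (by positivity)]
    congr 1
    norm_num
    rw [mul_comm]
  · simp [exponentialPDF_of_neg (not_le.1 hx), gammaPDF_of_neg (not_le.1 hx)]

theorem lintegral_expMeasure_sub {a : ℝ} (ha : 0 ≤ a) :
    ∫⁻ z, ENNReal.ofReal (z - a) ∂(expMeasure 1) = ENNReal.ofReal (Real.exp (-a)) := by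
  have h1 : ∫⁻ z, ENNReal.ofReal (z - a) ∂(expMeasure 1) =
      ∫⁻ z in Set.Ici a, ENNReal.ofReal (z - a) ∂(expMeasure 1) := by
    rw [← lintegral_indicator measurableSet_Ici]
    refine lintegral_congr fun z => ?_
    by_cases hz : a ≤ z
    · simp [hz]
    · simp [hz, (not_le.1 hz).le]
  rw [h1]
  have h2 := lintegral_map (μ := (expMeasure 1).restrict (Set.Ici a)) (f := ENNReal.ofReal)
    (g := fun z => z - a) (by fun_prop) (by fun_prop)
  rw [← h2, expMeasure_map_sub ha, lintegral_smul_measure, lintegral_expMeasure_id, smul_eq_mul,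
    mul_one]

/-- An upper bound on the components of a perturbation vector, of expectation `log N + 1`. -/
noncomputable def excessBound (z : Fin N → ℝ) : ℝ :=
  Real.log N + ∑ i, max (z i - Real.log N) 0

theorem excessBound_nonneg (z : Fin N → ℝ) : 0 ≤ excessBound z :=
  add_nonneg (Real.log_natCast_nonneg N) (Finset.sum_nonneg fun _ _ => le_max_right _ _)

theorem le_excessBound (z : Fin N → ℝ) (i : Fin N) : z i ≤ excessBound z := by
  have := Finset.single_le_sum (f := fun i => max (z i - Real.log N) 0)
    (fun i _ => le_max_right _ _) (Finset.mem_univ i)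
  have h2 := le_max_left (z i - Real.log N) 0
  unfold excessBound
  linarith

theorem dot_le_excessBound {m : ℕ} {v : Action N} (hv : v.card ≤ m) (z : Fin N → ℝ) :
    dot v z ≤ m * excessBound z := by
  have h1 : dot v z ≤ v.card • excessBound z := Finset.sum_le_card_nsmul _ _ _ fun i _ =>
    le_excessBound z i
  rw [nsmul_eq_mul] at h1
  exact h1.trans (mul_le_mul_of_nonneg_right (by exact_mod_cast hv) (excessBound_nonneg z))

theorem measurePreserving_eval_perturbationLaw (i : Fin N) :
    MeasurePreserving (Function.eval i) (perturbationLaw N) (expMeasure 1) :=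
  measurePreserving_eval _ i

theorem lintegral_perturbationLaw_sub (i : Fin N) {a : ℝ} (ha : 0 ≤ a) :
    ∫⁻ z, ENNReal.ofReal (z i - a) ∂(perturbationLaw N) = ENNReal.ofReal (Real.exp (-a)) := by
  rw [← lintegral_expMeasure_sub ha]
  exact (measurePreserving_eval_perturbationLaw i).lintegral_comp
    (f := fun x => ENNReal.ofReal (x - a)) (by fun_prop)

theorem integrable_max_sub (i : Fin N) {a : ℝ} (ha : 0 ≤ a) :
    Integrable (fun z : Fin N → ℝ => max (z i - a) 0) (perturbationLaw N) := by
  have hm : Measurable fun z : Fin N → ℝ => max (z i - a) 0 := by fun_prop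
  have h0 : 0 ≤ᵐ[perturbationLaw N] fun z : Fin N → ℝ => max (z i - a) 0 :=
    ae_of_all _ fun _ => le_max_right _ _
  refine ⟨hm.aestronglyMeasurable, ?_⟩
  rw [hasFiniteIntegral_iff_ofReal h0]
  simp only [ENNReal.ofReal_max, ENNReal.ofReal_zero, zero_le, sup_of_le_left]
  rw [lintegral_perturbationLaw_sub i ha]
  exact ENNReal.ofReal_lt_top

theorem integral_max_sub (i : Fin N) {a : ℝ} (ha : 0 ≤ a) :
    ∫ z, max (z i - a) 0 ∂(perturbationLaw N) = Real.exp (-a) := by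
  have hm : Measurable fun z : Fin N → ℝ => max (z i - a) 0 := by fun_prop
  have h0 : 0 ≤ᵐ[perturbationLaw N] fun z : Fin N → ℝ => max (z i - a) 0 :=
    ae_of_all _ fun _ => le_max_right _ _
  rw [integral_eq_lintegral_of_nonneg_ae h0 hm.aestronglyMeasurable]
  simp only [ENNReal.ofReal_max, ENNReal.ofReal_zero, zero_le, sup_of_le_left]
  rw [lintegral_perturbationLaw_sub i ha, ENNReal.toReal_ofReal (Real.exp_nonneg _)]

theorem integrable_excessBound : Integrable (excessBound (N := N)) (perturbationLaw N) :=
  (integrable_const _).add (integrable_finsetSum _ fun i _ =>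
    integrable_max_sub i (Real.log_natCast_nonneg N))

theorem integral_excessBound_le : ∫ z, excessBound z ∂(perturbationLaw N) ≤ Real.log N + 1 := by
  unfold excessBound
  rw [integral_add (integrable_const _) (integrable_finsetSum _ fun i _ =>
    integrable_max_sub i (Real.log_natCast_nonneg N)), integral_finsetSum _ fun i _ =>
    integrable_max_sub i (Real.log_natCast_nonneg N)]
  simp_rw [integral_max_sub _ (Real.log_natCast_nonneg N)]
  rcases Nat.eq_zero_or_pos N with rfl | hN
  · simp
  · have : (0 : ℝ) < N := by exact_mod_cast hN
    -- The threshold log N gives each of the N positive parts expectation 1/N, so together they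
    -- contribute 1.
    rw [Real.exp_neg, Real.exp_log this]
    simp [this.ne']

theorem ae_nonneg_perturbationLaw : ∀ᵐ z ∂(perturbationLaw N), ∀ i, 0 ≤ z i := by
  rw [ae_all_iff]
  intro i
  have h : ∀ᵐ x ∂(expMeasure 1), (0 : ℝ) ≤ x := by
    have := expMeasure_shift (y := 0) le_rfl (MeasurableSet.univ)
    simp only [Set.mem_univ, true_and, neg_zero, Real.exp_zero, ENNReal.ofReal_one, one_mul,
      measure_univ] at this
    exact (mem_ae_iff_prob_eq_one measurableSet_Ici).2 this
  exact (measurePreserving_eval_perturbationLaw i).quasiMeasurePreserving.ae h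

theorem integrable_apply_perturbationLaw (i : Fin N) :
    Integrable (fun z : Fin N → ℝ => z i) (perturbationLaw N) := by
  refine (integrable_max_sub i le_rfl).congr ?_
  filter_upwards [ae_nonneg_perturbationLaw] with z hz
  simp [hz i]

theorem integrable_dot_perturbationLaw (v : Action N) :
    Integrable (dot v) (perturbationLaw N) :=
  integrable_finsetSum _ fun i _ => integrable_apply_perturbationLaw i

end Perturbation

/-! ### The expected perturbed minimum as a potential -/

section Potential

variable {N : ℕ} {S : Finset (Action N)}

theorem dot_add (v : Action N) (x y : Fin N → ℝ) :
    dot v (fun i => x i + y i) = dot v x + dot v y := Finset.sum_add_distrib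

theorem dot_scale_sub (v : Action N) (η : ℝ) (x z : Fin N → ℝ) :
    dot v (fun i => η * x i - z i) = η * dot v x - dot v z := by
  simp only [dot, Finset.sum_sub_distrib, Finset.mul_sum]

theorem dot_nonneg (v : Action N) {x : Fin N → ℝ} (hx : ∀ i, 0 ≤ x i) : 0 ≤ dot v x :=
  Finset.sum_nonneg fun i _ => hx i

/-- The probability that the follow-the-perturbed-leader rule picks the action `u`. -/
noncomputable def leaderProb (S : Finset (Action N)) (η : ℝ) (L : Fin N → ℝ) (u : Action N) : ℝ :=
  (perturbationLaw N).real {z | perturbedLeader S η L z = u}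

theorem leaderProb_nonneg (S : Finset (Action N)) (η : ℝ) (L : Fin N → ℝ) (u : Action N) :
    0 ≤ leaderProb S η L u := measureReal_nonneg

theorem apply_perturbedLeader_eq_sum (S : Finset (Action N)) (η : ℝ) (L : Fin N → ℝ)
    (g : Action N → (Fin N → ℝ) → ℝ) :
    (fun z => g (perturbedLeader S η L z) z) =
      fun z => ∑ u, {z | perturbedLeader S η L z = u}.indicator (g u) z := by
  classical
  ext z
  simp [Set.indicator_apply]

theorem integrable_apply_perturbedLeader (hS : S.Nonempty) (η : ℝ) (L : Fin N → ℝ)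
    {g : Action N → (Fin N → ℝ) → ℝ} (hg : ∀ u, Integrable (g u) (perturbationLaw N)) :
    Integrable (fun z => g (perturbedLeader S η L z) z) (perturbationLaw N) := by
  rw [apply_perturbedLeader_eq_sum]
  exact integrable_finsetSum _ fun u _ =>
    (hg u).indicator (measurableSet_perturbedLeader_eq hS η L u)

theorem integral_apply_perturbedLeader (hS : S.Nonempty) (η : ℝ) (L : Fin N → ℝ)
    (f : Action N → ℝ) :
    ∫ z, f (perturbedLeader S η L z) ∂(perturbationLaw N) = ∑ u, leaderProb S η L u * f u := by
  have h := apply_perturbedLeader_eq_sum S η L (fun u _ => f u)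
  rw [h, integral_finsetSum _ fun u _ =>
    (integrable_const _).indicator (measurableSet_perturbedLeader_eq hS η L u)]
  refine Finset.sum_congr rfl fun u _ => ?_
  rw [integral_indicator_const _ (measurableSet_perturbedLeader_eq hS η L u), smul_eq_mul]
  rfl

theorem leaderProb_eq_zero (hS : S.Nonempty) (η : ℝ) (L : Fin N → ℝ) {u : Action N} (hu : u ∉ S) :
    leaderProb S η L u = 0 := by
  have : {z | perturbedLeader S η L z = u} = ∅ := by
    ext z
    simp only [Set.mem_ofPred_eq, Set.mem_empty_iff_false, iff_false]
    exact fun h => hu (h ▸ leader_mem hS _)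
  rw [leaderProb, this, measureReal_empty]

theorem sum_leaderProb (hS : S.Nonempty) (η : ℝ) (L : Fin N → ℝ) :
    ∑ u, leaderProb S η L u = 1 := by
  have := integral_apply_perturbedLeader hS η L (fun _ => 1)
  simpa using this.symm

/-- Shift only the perturbations of components in `u`. The shift compensates the added loss on `u`,
while the losses elsewhere only grow, so `u` stays the leader. The price is therefore exp(-η uᵀx),
not the sum over all components. -/
theorem exp_neg_mul_leaderProb_le (hS : S.Nonempty) {η : ℝ} (hη : 0 ≤ η) (L : Fin N → ℝ)
    {x : Fin N → ℝ} (hx : ∀ i, 0 ≤ x i) (u : Action N) :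
    Real.exp (-(η * dot u x)) * leaderProb S η L u ≤
      leaderProb S η (fun i => L i + x i) u := by
  classical
  have h := exp_neg_mul_perturbationLaw_le (y := fun i => if i ∈ u then η * x i else 0)
    (fun i => by have := hx i; split_ifs <;> positivity)
    (measurableSet_perturbedLeader_eq hS η L u)
  have e : ∑ i, (if i ∈ u then η * x i else 0) = η * dot u x := by
    rw [dot, Finset.mul_sum, ← Finset.sum_filter]
    simp
  rw [e] at h
  refine h.trans (measureReal_mono fun z hz => ?_)
  refine leader_eq_of_le hS (u := u) hz (fun i => ?_) fun i hi => ?_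
  · have := mul_nonneg hη (hx i)
    dsimp only
    split_ifs <;> linarith
  · simp only [hi, if_true]; ring

/-- The expected minimum of the perturbed cumulative losses `vᵀ (L - Z / η)`. -/
noncomputable def potential (S : Finset (Action N)) (η : ℝ) (L : Fin N → ℝ) : ℝ :=
  η⁻¹ * ∫ z, dot (perturbedLeader S η L z) (fun i => η * L i - z i) ∂(perturbationLaw N)

theorem integrable_dot_scale_sub (η : ℝ) (L : Fin N → ℝ) (u : Action N) :
    Integrable (fun z => dot u (fun i => η * L i - z i)) (perturbationLaw N) := by
  simp only [dot_scale_sub]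
  exact (integrable_const _).sub (integrable_dot_perturbationLaw u)

theorem integrable_potential (hS : S.Nonempty) (η : ℝ) (L : Fin N → ℝ) :
    Integrable (fun z => dot (perturbedLeader S η L z) (fun i => η * L i - z i))
      (perturbationLaw N) :=
  integrable_apply_perturbedLeader hS η L (g := fun u z => dot u (fun i => η * L i - z i))
    fun u => integrable_dot_scale_sub η L u

/-- The leader for `L + x` is a candidate for `L`, so the potential grows by at least its expected
`x`-loss; the shift bound and exp(-y) ≥ 1 - y then replace the new leader law by the old one. -/
theorem sum_leaderProb_mul_le_potential_sub (hS : S.Nonempty) {η : ℝ} (hη : 0 < η)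
    (L : Fin N → ℝ) {x : Fin N → ℝ} (hx : ∀ i, 0 ≤ x i) :
    ∑ u, leaderProb S η L u * (dot u x - η * dot u x ^ 2) ≤
      potential S η (fun i => L i + x i) - potential S η L := by
  set L' : Fin N → ℝ := fun i => L i + x i with hL'
  have h1 : ∑ u, leaderProb S η L u * (dot u x - η * dot u x ^ 2) ≤
      ∑ u, leaderProb S η L' u * dot u x := by
    refine Finset.sum_le_sum fun u _ => ?_
    have h2 := exp_neg_mul_leaderProb_le hS hη.le L hx u
    have h3 := Real.add_one_le_exp (-(η * dot u x))
    have h4 := dot_nonneg u hx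
    have h5 := leaderProb_nonneg S η L u
    calc _ = ((-(η * dot u x) + 1) * leaderProb S η L u) * dot u x := by ring
      _ ≤ _ := mul_le_mul_of_nonneg_right
        ((mul_le_mul_of_nonneg_right h3 h5).trans h2) h4
  refine h1.trans ?_
  rw [← integral_apply_perturbedLeader hS η L' (fun u => dot u x)]
  unfold potential
  rw [← mul_sub, ← integral_sub (integrable_potential hS η L') (integrable_potential hS η L),
    ← integral_const_mul]
  refine integral_mono (integrable_apply_perturbedLeader hS η L' (g := fun u _ => dot u x)
    fun u => integrable_const _)
    (((integrable_potential hS η L').sub (integrable_potential hS η L)).const_mul _) fun z => ?_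
  have h := dot_leader_le hS (fun i => η * L i - z i) (leader_mem hS (fun i => η * L' i - z i))
  have e := dot_scale_sub (perturbedLeader S η L' z) η L' z
  have e2 := dot_scale_sub (perturbedLeader S η L' z) η L z
  have e3 : dot (perturbedLeader S η L' z) L' =
    dot (perturbedLeader S η L' z) L + dot (perturbedLeader S η L' z) x := dot_add _ _ _
  change dot (perturbedLeader S η L z) _ ≤ dot (perturbedLeader S η L' z) _ at h
  change dot (perturbedLeader S η L' z) x ≤ η⁻¹ * (dot (perturbedLeader S η L' z) _ -
    dot (perturbedLeader S η L z) _)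
  rw [inv_mul_eq_div, le_div_iff₀ hη, e, e3]
  rw [e2] at h
  linarith

theorem potential_le_dot (hS : S.Nonempty) {η : ℝ} (hη : 0 < η) (L : Fin N → ℝ) {v : Action N}
    (hv : v ∈ S) : potential S η L ≤ dot v L := by
  unfold potential
  rw [inv_mul_eq_div, div_le_iff₀ hη]
  have h := integral_mono (integrable_potential hS η L) (integrable_dot_scale_sub η L v)
    fun z => dot_leader_le hS (fun i => η * L i - z i) hv
  refine h.trans ?_
  simp only [dot_scale_sub]
  rw [integral_sub (integrable_const _) (integrable_dot_perturbationLaw v)]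
  have h2 : 0 ≤ ∫ z, dot v z ∂(perturbationLaw N) := by
    refine integral_nonneg_of_ae ?_
    filter_upwards [ae_nonneg_perturbationLaw] with z hz using dot_nonneg v hz
  simp
  linarith

theorem integrable_potential_error (m : ℕ) (c : ℝ) :
    Integrable (fun z : Fin N → ℝ => c * (m * excessBound z)) (perturbationLaw N) :=
  (integrable_excessBound.const_mul _).const_mul _

theorem integral_potential_error_le (m : ℕ) {c : ℝ} (hc : 0 ≤ c) :
    ∫ z : Fin N → ℝ, c * (m * excessBound z) ∂(perturbationLaw N) ≤
      c * (m * (Real.log N + 1)) := by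
  rw [integral_const_mul, integral_const_mul]
  have := integral_excessBound_le (N := N)
  gcongr

/-- Couple the two parameters through the same `z`: the leader for `η'` is a candidate for `η`, and
its value changes by (1/η' - 1/η) uᵀz. -/
theorem potential_le_potential_add (hS : S.Nonempty) {m : ℕ} (hm : ∀ v ∈ S, v.card ≤ m)
    {η η' : ℝ} (hη' : 0 < η') (hle : η' ≤ η) (L : Fin N → ℝ) :
    potential S η L ≤ potential S η' L + (η'⁻¹ - η⁻¹) * (m * (Real.log N + 1)) := by
  have hη : 0 < η := hη'.trans_le hle
  have hc : 0 ≤ η'⁻¹ - η⁻¹ := sub_nonneg.2 (inv_anti₀ hη' hle)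
  refine le_trans ?_ (add_le_add le_rfl (integral_potential_error_le m hc))
  unfold potential
  rw [← integral_const_mul, ← integral_const_mul, ← integral_add
    ((integrable_potential hS η' L).const_mul _) (integrable_potential_error m _)]
  refine integral_mono ((integrable_potential hS η L).const_mul _)
    (((integrable_potential hS η' L).const_mul _).add (integrable_potential_error m _))
    fun z => ?_
  set u := perturbedLeader S η' L z with hu
  have huS : u ∈ S := leader_mem hS _
  have h := dot_leader_le hS (fun i => η * L i - z i) huS
  have hX := dot_le_excessBound (hm u huS) z
  change η⁻¹ * dot (leader S _) _ ≤ η'⁻¹ * dot u _ + _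
  refine (mul_le_mul_of_nonneg_left h (inv_nonneg.2 hη.le)).trans ?_
  rw [dot_scale_sub, dot_scale_sub, mul_sub, mul_sub, inv_mul_cancel_left₀ hη.ne',
    inv_mul_cancel_left₀ hη'.ne']
  have := mul_le_mul_of_nonneg_left hX hc
  linarith

theorem potential_zero_add_nonneg (hS : S.Nonempty) {m : ℕ} (hm : ∀ v ∈ S, v.card ≤ m)
    {η : ℝ} (hη : 0 < η) :
    0 ≤ potential S η (fun _ => 0) + η⁻¹ * (m * (Real.log N + 1)) := by
  refine le_trans ?_ (add_le_add le_rfl (integral_potential_error_le m (inv_nonneg.2 hη.le)))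
  unfold potential
  rw [← integral_const_mul, ← integral_add
    ((integrable_potential hS η _).const_mul _) (integrable_potential_error m _)]
  refine integral_nonneg fun z => ?_
  have huS : perturbedLeader S η (fun _ => 0) z ∈ S := leader_mem hS _
  have hX := dot_le_excessBound (hm _ huS) z
  have e := dot_scale_sub (perturbedLeader S η (fun _ => 0) z) η (fun _ => 0) z
  have e0 : dot (perturbedLeader S η (fun _ => 0) z) (fun _ => 0) = 0 := by simp [dot]
  simp only [Pi.zero_apply]
  rw [e, e0]
  have := mul_le_mul_of_nonneg_left hX (inv_nonneg.2 hη.le)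
  linarith

end Potential

/-! ### Pathwise regret in terms of the loss estimates -/

section Pathwise

variable {N : ℕ}

open Classical in
/-- The loss estimates of one round. -/
noncomputable def roundEstimate (E : Environment N) (h : List (Round N)) (r : Round N)
    (i : Fin N) : ℝ :=
  (r.resample i : ℝ) * (if Observed (E.graph (actions h)) r.action i then 1 else 0) *
    E.loss (actions h) i

theorem lossEstimate_cons (E : Environment N) (h : List (Round N)) (r : Round N) :
    lossEstimate E (r :: h) = fun i => lossEstimate E h i + roundEstimate E h r i := rfl

theorem lossEstimate_nil (E : Environment N) : lossEstimate E [] = fun _ => 0 := rfl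

/-- The sum of the increments `D` along a history. -/
def cumulative (D : List (Round N) → Round N → ℝ) : List (Round N) → ℝ
  | [] => 0
  | r :: h => cumulative D h + D h r

/-- The regret of one round against `v`, measured by the loss estimates and with a quadratic
correction. -/
noncomputable def estimatedGap (m : ℕ) (S : Finset (Action N)) (E : Environment N)
    (approx : List (Action N) → ℝ) (v : Action N) (h : List (Round N)) (r : Round N) : ℝ :=
  ∑ u, leaderProb S (rate m approx (actions h)) (lossEstimate E h) u *
    (dot u (roundEstimate E h r) - rate m approx (actions h) * dot u (roundEstimate E h r) ^ 2) -
    dot v (roundEstimate E h r)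

theorem roundEstimate_nonneg {E : Environment N} {h : List (Round N)}
    (hE : ∀ i, 0 ≤ E.loss (actions h) i) (r : Round N) (i : Fin N) :
    0 ≤ roundEstimate E h r i := by
  have := hE i
  unfold roundEstimate
  split_ifs <;> positivity

/-- No probability over histories is involved: the adaptive parameters depend on the actions, and
the bound holds along each history separately. -/
theorem cumulative_estimatedGap_le {m T : ℕ} {S : Finset (Action N)} (hS : S.Nonempty)
    (hm : ∀ v ∈ S, v.card ≤ m) {E : Environment N} {approx : List (Action N) → ℝ}
    (hE : ∀ a : List (Action N), a.length < T → ∀ i, 0 ≤ E.loss a i)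
    (hpos : ∀ a : List (Action N), a.length ≤ T → 0 < rate m approx a)
    (hanti : ∀ (u : Action N) (a : List (Action N)), a.length < T →
      rate m approx (u :: a) ≤ rate m approx a)
    {v : Action N} (hv : v ∈ S) {h : List (Round N)} (hh : h.length ≤ T) :
    cumulative (estimatedGap m S E approx v) h ≤
      (rate m approx (actions h))⁻¹ * (m * (Real.log N + 1)) := by
  have hlen : ∀ h : List (Round N), (actions h).length = h.length := fun h => List.length_map _
  -- Keeping the potential in the claim makes the induction telescope, both in the potential and in
  -- the cost of changing η. The last parameter is the one following the whole history `h`.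
  suffices H : cumulative (estimatedGap m S E approx v) h ≤
      potential S (rate m approx (actions h)) (lossEstimate E h) - dot v (lossEstimate E h) +
        (rate m approx (actions h))⁻¹ * (m * (Real.log N + 1)) by
    have := potential_le_dot hS (hpos (actions h) (by rwa [hlen])) (lossEstimate E h) hv
    linarith
  induction h with
  | nil =>
    have := potential_zero_add_nonneg hS hm (hpos [] (Nat.zero_le _))
    simpa [cumulative, lossEstimate_nil, dot, actions] using this
  | cons r h ih =>
    have hlt : (actions h).length < T := by rw [hlen]; exact hh
    have ih := ih (Nat.le_of_succ_le hh)
    have hη := hpos (actions h) hlt.le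
    have h1 := sum_leaderProb_mul_le_potential_sub hS hη (lossEstimate E h)
      (roundEstimate_nonneg (hE _ hlt) r)
    have h2 := potential_le_potential_add hS hm (hpos (actions (r :: h)) (by rwa [hlen]))
      (show _ ≤ rate m approx (actions h) from hanti r.action _ hlt) (lossEstimate E (r :: h))
    have h3 : dot v (lossEstimate E (r :: h)) =
      dot v (lossEstimate E h) + dot v (roundEstimate E h r) := dot_add _ _ _
    rw [← lossEstimate_cons] at h1
    simp only [cumulative, estimatedGap]
    linarith

end Pathwise

/-! ### The joint law of an action and its resampling counts -/

section RoundLaw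

instance (N : ℕ) : Countable (Round N) :=
  Function.Injective.countable (f := fun r : Round N => (r.action, r.resample))
    fun r s h => by cases r; cases s; simp_all

theorem geometricMeasure_real_Ici {p : unitInterval} (hp : p ≠ 0) (k : ℕ) :
    (geometricMeasure p).real (Set.Ici k) = (1 - p : ℝ) ^ k := by
  induction k with
  | zero => simp [show Set.Ici 0 = (Set.univ : Set ℕ) from Set.Ici_bot]
  | succ k ih =>
    have h : Set.Ici k = {k} ∪ Set.Ici (k + 1) := by
      ext n; simp only [Set.mem_Ici, Set.mem_union, Set.mem_singleton_iff]; omega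
    rw [h, measureReal_union (by simp) measurableSet_Ici, geometricMeasure_real_singleton hp] at ih
    rw [pow_succ]
    linarith

variable {N : ℕ} {S : Finset (Action N)}

/-- Turns tail events of the count into product events in the independent noise. As U is the failure
count `ω.2 i` plus one, k < U reads `k ≤ ω.2 i`. -/
theorem lt_resample_iff (G : Digraph (Fin N)) (η : ℝ) (L : Fin N → ℝ)
    (ω : (ℕ → Fin N → ℝ) × (Fin N → ℕ)) (i : Fin N) (k : ℕ) :
    k < (playRound S G η L ω).resample i ↔
      (∀ j, 1 ≤ j → j ≤ k → ¬ Observed G (perturbedLeader S η L (ω.1 j)) i) ∧ k ≤ ω.2 i := by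
  set s : Set ℕ := {k : ℕ | 1 ≤ k ∧ Observed G (perturbedLeader S η L (ω.1 k)) i} ∪ {ω.2 i + 1}
    with hs
  have hmem : sInf s ∈ s := Nat.sInf_mem ⟨ω.2 i + 1, Or.inr rfl⟩
  change k < sInf s ↔ _
  constructor
  · refine fun h => ⟨fun j hj hjk hO => ?_, ?_⟩
    · exact Nat.notMem_of_lt_sInf (hjk.trans_lt h) (Or.inl ⟨hj, hO⟩)
    · have : sInf s ≤ ω.2 i + 1 := Nat.sInf_le (Or.inr rfl)
      omega
  · rintro ⟨h1, h2⟩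
    by_contra! hle
    rcases hmem with h | h
    · exact h1 _ h.1 hle h.2
    · simp only [Set.mem_singleton_iff] at h
      omega

theorem setOf_action_and_lt_resample (G : Digraph (Fin N)) (η : ℝ) (L : Fin N → ℝ)
    (p : Action N → Prop) (i : Fin N) (k : ℕ) :
    {ω | p (playRound S G η L ω).action ∧ k < (playRound S G η L ω).resample i} =
      Set.pi (Finset.range (k + 1)) (fun j => if j = 0 then {z | p (perturbedLeader S η L z)}
        else {z | ¬ Observed G (perturbedLeader S η L z) i}) ×ˢ (Function.eval i ⁻¹' Set.Ici k) := by
  ext ω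
  simp only [Set.mem_ofPred_eq, lt_resample_iff, Set.mem_prod, Set.mem_pi, Finset.coe_range,
    Set.mem_Iio, Set.mem_preimage, Function.eval, Set.mem_Ici, ← and_assoc]
  refine and_congr_left fun _ => ⟨fun h j hj => ?_, fun h => ⟨?_, fun j hj hjk => ?_⟩⟩
  · rcases Nat.eq_zero_or_pos j with rfl | hj0
    · rw [if_pos rfl]; exact h.1
    · simpa [hj0.ne'] using h.2 j hj0 (by omega)
  · have := h 0 (by omega)
    rw [if_pos rfl] at this
    exact this
  · have := h j (by omega)
    simpa [show j ≠ 0 by omega] using this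

theorem measurableSet_action_and_lt_resample (hS : S.Nonempty) (G : Digraph (Fin N)) (η : ℝ)
    (L : Fin N → ℝ) (p : Action N → Prop) (i : Fin N) (k : ℕ) :
    MeasurableSet
      {ω | p (playRound S G η L ω).action ∧ k < (playRound S G η L ω).resample i} := by
  rw [setOf_action_and_lt_resample]
  refine MeasurableSet.prod (MeasurableSet.pi (Set.to_countable _) fun j _ => ?_)
    (measurableSet_Ici.preimage (measurable_pi_apply i))
  split_ifs
  · exact measurableSet_perturbedLeader hS η L p
  · exact measurableSet_perturbedLeader hS η L (fun u => ¬ Observed G u i)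

theorem measurable_playRound (hS : S.Nonempty) (G : Digraph (Fin N)) (η : ℝ) (L : Fin N → ℝ) :
    Measurable (playRound S G η L) := by
  have hact : ∀ u, MeasurableSet {ω | (playRound S G η L ω).action = u} := fun u =>
    (measurableSet_perturbedLeader_eq hS η L u).preimage
      (f := fun ω : (ℕ → Fin N → ℝ) × (Fin N → ℕ) => ω.1 0) (by fun_prop)
  have hres : ∀ i, Measurable fun ω => (playRound S G η L ω).resample i := fun i =>
    measurable_of_Ioi fun k => by
      have := measurableSet_action_and_lt_resample hS G η L (fun _ => True) i k
      simp only [true_and] at this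
      exact this
  refine measurable_to_countable' fun r => ?_
  have : playRound S G η L ⁻¹' {r} = {ω | (playRound S G η L ω).action = r.action} ∩
      ⋂ i, (fun ω => (playRound S G η L ω).resample i) ⁻¹' {r.resample i} := by
    ext ω
    simp only [Set.mem_preimage, Set.mem_singleton_iff, Set.mem_inter_iff, Set.mem_ofPred_eq,
      Set.mem_iInter]
    constructor
    · rintro rfl; simp
    · rintro ⟨h1, h2⟩
      have h3 := funext h2
      revert h1 h3
      generalize playRound S G η L ω = q
      cases q; cases r
      rintro rfl rfl
      rfl
  rw [this]
  exact (hact _).inter (MeasurableSet.iInter fun i => hres i (measurableSet_singleton _))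

instance (γ : ℝ) : IsProbabilityMeasure (noiseLaw N γ) := by
  unfold noiseLaw; infer_instance

/-- The law of one round, as a function of the graph, the parameter and the loss estimates. -/
noncomputable def playLaw (S : Finset (Action N)) (G : Digraph (Fin N)) (η : ℝ) (L : Fin N → ℝ) :
    Measure (Round N) := (noiseLaw N η).map (playRound S G η L)

theorem isProbabilityMeasure_playLaw (hS : S.Nonempty) (G : Digraph (Fin N)) (η : ℝ)
    (L : Fin N → ℝ) : IsProbabilityMeasure (playLaw S G η L) :=
  Measure.isProbabilityMeasure_map (measurable_playRound hS G η L).aemeasurable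

/-- The probability that the component `i` is observed. -/
noncomputable def obsProb (S : Finset (Action N)) (G : Digraph (Fin N)) (η : ℝ) (L : Fin N → ℝ)
    (i : Fin N) : ℝ :=
  (perturbationLaw N).real {z | Observed G (perturbedLeader S η L z) i}

theorem obsProb_nonneg (S : Finset (Action N)) (G : Digraph (Fin N)) (η : ℝ) (L : Fin N → ℝ)
    (i : Fin N) : 0 ≤ obsProb S G η L i := measureReal_nonneg

theorem obsProb_le_one (S : Finset (Action N)) (G : Digraph (Fin N)) (η : ℝ) (L : Fin N → ℝ)
    (i : Fin N) : obsProb S G η L i ≤ 1 := measureReal_le_one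

/-- Perturbation 0 decides the observation, perturbations 1, …, k must all miss `i`, and the
geometric variable must survive k trials; all of these are independent. -/
theorem playLaw_observed_and_lt_resample (hS : S.Nonempty) (G : Digraph (Fin N)) {η : ℝ}
    (hη : 0 < η) (hη1 : η ≤ 1) (L : Fin N → ℝ) (i : Fin N) (k : ℕ) :
    playLaw S G η L {r | Observed G r.action i ∧ k < r.resample i} =
      ENNReal.ofReal (obsProb S G η L i * ((1 - obsProb S G η L i) * (1 - η)) ^ k) := by
  have hO := obsProb_nonneg S G η L i
  have hO1 := obsProb_le_one S G η L i
  have hp : (Set.projIcc 0 1 zero_le_one η : unitInterval) ≠ 0 := by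
    rw [Set.projIcc_of_mem zero_le_one ⟨hη.le, hη1⟩]
    exact fun h => hη.ne' (congrArg Subtype.val h)
  have hpv : ((Set.projIcc 0 1 zero_le_one η : unitInterval) : ℝ) = η := by
    rw [Set.projIcc_of_mem zero_le_one ⟨hη.le, hη1⟩]
  have hgeo : (Measure.pi fun _ : Fin N => geometricMeasure (Set.projIcc 0 1 zero_le_one η))
      (Function.eval i ⁻¹' Set.Ici k) = ENNReal.ofReal ((1 - η) ^ k) := by
    have e := (measurePreserving_eval
      (fun _ : Fin N => geometricMeasure (Set.projIcc 0 1 zero_le_one η)) i).measure_preimage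
        (measurableSet_Ici (a := k)).nullMeasurableSet
    rw [e, ← ofReal_measureReal, geometricMeasure_real_Ici hp, hpv]
  have hnot : perturbationLaw N {z | ¬ Observed G (perturbedLeader S η L z) i} =
      ENNReal.ofReal (1 - obsProb S G η L i) := by
    rw [← ofReal_measureReal]
    congr 1
    exact probReal_compl_eq_one_sub (measurableSet_perturbedLeader hS η L (fun u => Observed G u i))
  rw [playLaw, Measure.map_apply (measurable_playRound hS G η L) trivial]
  change noiseLaw N η {ω | Observed G (playRound S G η L ω).action i ∧ _} = _
  rw [setOf_action_and_lt_resample G η L (fun u => Observed G u i), noiseLaw, Measure.prod_prod,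
    hgeo, Measure.infinitePi_pi, Finset.prod_range_succ']
  · simp only [Nat.add_eq_zero_iff, one_ne_zero, and_false, if_false, if_true, hnot,
      Finset.prod_const, Finset.card_range]
    rw [← ofReal_measureReal (s := {z | Observed G (perturbedLeader S η L z) i}),
      ← ENNReal.ofReal_pow (by linarith), ← ENNReal.ofReal_mul (by positivity),
      ← ENNReal.ofReal_mul (by positivity)]
    congr 1
    rw [mul_pow, obsProb]
    ring
  · intro j _
    split_ifs
    · exact measurableSet_perturbedLeader hS η L (fun u => Observed G u i)
    · exact measurableSet_perturbedLeader hS η L (fun u => ¬ Observed G u i)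

/-- Layer-cake formula. It serves both moments of the count: `c k = 1` gives K, and `c k = 2k + 1`
gives K². -/
theorem lintegral_observed_mul_sum_range (hS : S.Nonempty) (G : Digraph (Fin N)) {η : ℝ}
    (hη : 0 < η) (hη1 : η ≤ 1) (L : Fin N → ℝ) (i : Fin N) {c : ℕ → ℝ} (hc : ∀ k, 0 ≤ c k) {s : ℝ}
    (hs : HasSum (fun k => c k * ((1 - obsProb S G η L i) * (1 - η)) ^ k) s) :
    ∫⁻ r, ENNReal.ofReal ({r : Round N | Observed G r.action i}.indicator
      (fun r => ∑ k ∈ Finset.range (r.resample i), c k) r) ∂(playLaw S G η L) =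
      ENNReal.ofReal (obsProb S G η L i * s) := by
  classical
  have hO := obsProb_nonneg S G η L i
  have hO1 := obsProb_le_one S G η L i
  have hx : 0 ≤ (1 - obsProb S G η L i) * (1 - η) := mul_nonneg (by linarith) (by linarith)
  have h1 : ∀ r : Round N, ENNReal.ofReal ({r : Round N | Observed G r.action i}.indicator
      (fun r => ∑ k ∈ Finset.range (r.resample i), c k) r) =
      ∑' k, {r : Round N | Observed G r.action i ∧ k < r.resample i}.indicator
        (fun _ => ENNReal.ofReal (c k)) r := by
    intro r
    by_cases hr : Observed G r.action i
    · rw [Set.indicator_of_mem (by exact hr), ENNReal.ofReal_sum_of_nonneg fun k _ => hc k,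
        tsum_eq_sum (s := Finset.range (r.resample i))]
      · refine Finset.sum_congr rfl fun k hk => ?_
        rw [Set.indicator_of_mem]
        exact ⟨hr, Finset.mem_range.1 hk⟩
      · intro k hk
        rw [Set.indicator_of_notMem]
        exact fun h => hk (Finset.mem_range.2 h.2)
    · simp [hr]
  simp_rw [h1]
  rw [lintegral_tsum fun k => measurable_from_top.aemeasurable]
  have hms : ∀ k, MeasurableSet {r : Round N | Observed G r.action i ∧ k < r.resample i} :=
    fun _ => trivial
  simp_rw [lintegral_indicator_const (hms _), playLaw_observed_and_lt_resample hS G hη hη1, ← ENNReal.ofReal_mul (hc _)]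
  rw [← ENNReal.ofReal_tsum_of_nonneg]
  · congr 1
    rw [← (hs.mul_left _).tsum_eq]
    exact tsum_congr fun k => by ring
  · intro k
    have := hc k
    positivity
  · exact (hs.summable.mul_left (obsProb S G η L i)).congr fun k => by ring

theorem integrable_observed_mul_sum_range (hS : S.Nonempty) (G : Digraph (Fin N)) {η : ℝ}
    (hη : 0 < η) (hη1 : η ≤ 1) (L : Fin N → ℝ) (i : Fin N) {c : ℕ → ℝ} (hc : ∀ k, 0 ≤ c k) {s : ℝ}
    (hs : HasSum (fun k => c k * ((1 - obsProb S G η L i) * (1 - η)) ^ k) s) :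
    Integrable ({r : Round N | Observed G r.action i}.indicator
      (fun r => ∑ k ∈ Finset.range (r.resample i), c k)) (playLaw S G η L) ∧
    ∫ r, {r : Round N | Observed G r.action i}.indicator
      (fun r => ∑ k ∈ Finset.range (r.resample i), c k) r ∂(playLaw S G η L) =
      obsProb S G η L i * s := by
  have hO := obsProb_nonneg S G η L i
  have hO1 := obsProb_le_one S G η L i
  have hx : 0 ≤ (1 - obsProb S G η L i) * (1 - η) := mul_nonneg (by linarith) (by linarith)
  have hs0 : 0 ≤ s := hs.nonneg fun k => by have := hc k; positivity
  have h := lintegral_observed_mul_sum_range hS G hη hη1 L i hc hs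
  have h0 : 0 ≤ᵐ[playLaw S G η L] {r : Round N | Observed G r.action i}.indicator
      (fun r => ∑ k ∈ Finset.range (r.resample i), c k) :=
    ae_of_all _ fun r => Set.indicator_nonneg (fun r _ => Finset.sum_nonneg fun k _ => hc k) r
  have hm : AEStronglyMeasurable ({r : Round N | Observed G r.action i}.indicator
      (fun r => ∑ k ∈ Finset.range (r.resample i), c k)) (playLaw S G η L) :=
    measurable_from_top.aestronglyMeasurable
  refine ⟨⟨hm, ?_⟩, ?_⟩
  · rw [hasFiniteIntegral_iff_ofReal h0, h]
    exact ENNReal.ofReal_lt_top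
  · rw [integral_eq_lintegral_of_nonneg_ae h0 hm, h, ENNReal.toReal_ofReal (by positivity)]

theorem integral_action_playLaw (hS : S.Nonempty) (G : Digraph (Fin N)) (η : ℝ) (L : Fin N → ℝ)
    (f : Action N → ℝ) :
    ∫ r, f r.action ∂(playLaw S G η L) = ∑ u, leaderProb S η L u * f u := by
  rw [playLaw, integral_map (measurable_playRound hS G η L).aemeasurable
    measurable_from_top.aestronglyMeasurable, ← integral_apply_perturbedLeader hS]
  have h1 : MeasurePreserving (fun ω : (ℕ → Fin N → ℝ) × (Fin N → ℕ) => ω.1 0) (noiseLaw N η)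
      (perturbationLaw N) :=
    (measurePreserving_eval_infinitePi (fun _ : ℕ => perturbationLaw N) 0).comp
      measurePreserving_fst
  have h2 := (integrable_apply_perturbedLeader hS η L (g := fun u _ => f u)
    fun u => integrable_const _).aestronglyMeasurable
  rw [← h1.map_eq] at h2 ⊢
  rw [integral_map h1.measurable.aemeasurable h2]
  rfl

end RoundLaw

/-! ### First and second moments of the loss estimates -/

section Moments

variable {N : ℕ} {S : Finset (Action N)}

/-- The success probability of the geometric resampling of the component `i`. -/
noncomputable def resampleRate (S : Finset (Action N)) (G : Digraph (Fin N)) (η : ℝ)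
    (L : Fin N → ℝ) (i : Fin N) : ℝ :=
  1 - (1 - obsProb S G η L i) * (1 - η)

theorem obsProb_le_resampleRate (G : Digraph (Fin N)) {η : ℝ} (hη : 0 ≤ η) (L : Fin N → ℝ)
    (i : Fin N) : obsProb S G η L i ≤ resampleRate S G η L i := by
  have h := obsProb_le_one S G η L i
  unfold resampleRate
  nlinarith

theorem le_resampleRate (G : Digraph (Fin N)) {η : ℝ} (hη : η ≤ 1) (L : Fin N → ℝ)
    (i : Fin N) : η ≤ resampleRate S G η L i := by
  have h := obsProb_nonneg S G η L i
  unfold resampleRate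
  nlinarith

theorem sum_range_two_mul_add_one (n : ℕ) :
    ∑ k ∈ Finset.range n, (2 * (k : ℝ) + 1) = (n : ℝ) ^ 2 := by
  induction n with
  | zero => simp
  | succ n ih => rw [Finset.sum_range_succ, ih]; push_cast; ring

theorem roundEstimate_eq_indicator (E : Environment N) (h : List (Round N)) (i : Fin N) :
    (fun r => roundEstimate E h r i) =
      fun r => {r : Round N | Observed (E.graph (actions h)) r.action i}.indicator
        (fun r => ∑ _k ∈ Finset.range (r.resample i), (1 : ℝ)) r * E.loss (actions h) i := by
  classical
  ext r
  by_cases hr : Observed (E.graph (actions h)) r.action i <;> simp [roundEstimate, hr]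

theorem roundEstimate_sq_eq_indicator (E : Environment N) (h : List (Round N)) (i : Fin N) :
    (fun r => roundEstimate E h r i ^ 2) =
      fun r => {r : Round N | Observed (E.graph (actions h)) r.action i}.indicator
        (fun r => ∑ k ∈ Finset.range (r.resample i), (2 * (k : ℝ) + 1)) r *
          E.loss (actions h) i ^ 2 := by
  classical
  ext r
  by_cases hr : Observed (E.graph (actions h)) r.action i <;>
    simp [roundEstimate, hr, sum_range_two_mul_add_one, mul_pow]

variable (hS : S.Nonempty) (E : Environment N) (h : List (Round N)) {η : ℝ} (hη : 0 < η)
  (hη1 : η ≤ 1) (L : Fin N → ℝ)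

include hη hη1

theorem hasSum_resample_pow (G : Digraph (Fin N)) (i : Fin N) :
    HasSum (fun k => (1 : ℝ) * ((1 - obsProb S G η L i) * (1 - η)) ^ k)
      (resampleRate S G η L i)⁻¹ := by
  have hO := obsProb_nonneg S G η L i
  have hO1 := obsProb_le_one S G η L i
  have hx : 0 ≤ (1 - obsProb S G η L i) * (1 - η) := mul_nonneg (by linarith) (by linarith)
  have hρ := hη.trans_le (le_resampleRate (S := S) G hη1 L i)
  simp only [one_mul]
  exact hasSum_geometric_of_lt_one hx (by unfold resampleRate at hρ; linarith)

theorem exists_hasSum_resample_odd_pow (G : Digraph (Fin N)) (i : Fin N) :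
    ∃ s ≤ 2 / resampleRate S G η L i ^ 2,
      HasSum (fun k : ℕ => (2 * (k : ℝ) + 1) * ((1 - obsProb S G η L i) * (1 - η)) ^ k) s := by
  have hO := obsProb_nonneg S G η L i
  have hO1 := obsProb_le_one S G η L i
  have hx : 0 ≤ (1 - obsProb S G η L i) * (1 - η) := mul_nonneg (by linarith) (by linarith)
  have hρ := hη.trans_le (le_resampleRate (S := S) G hη1 L i)
  have h1 := hasSum_resample_pow (S := S) hη hη1 L G i
  have hdef : resampleRate S G η L i = 1 - (1 - obsProb S G η L i) * (1 - η) := rfl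
  set x := (1 - obsProb S G η L i) * (1 - η)
  set ρ := resampleRate S G η L i
  have hx1 : ‖x‖ < 1 := by rw [Real.norm_of_nonneg hx]; linarith
  have h2 := hasSum_coe_mul_geometric_of_norm_lt_one hx1
  -- With x = 1 - ρ the sum equals (2x + ρ)/ρ² = (2 - ρ)/ρ².
  refine ⟨2 * (x / (1 - x) ^ 2) + ρ⁻¹, ?_, ?_⟩
  · rw [← hdef]
    have : 2 * (x / ρ ^ 2) + ρ⁻¹ = (2 * x + ρ) / ρ ^ 2 := by field_simp
    rw [this]
    gcongr
    linarith
  · have e : (fun k : ℕ => (2 * (k : ℝ) + 1) * x ^ k) =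
        fun k : ℕ => 2 * ((k : ℝ) * x ^ k) + 1 * x ^ k := funext fun k => by ring
    rw [e]
    exact (h2.mul_left 2).add h1

include hS

theorem integrable_roundEstimate (i : Fin N) :
    Integrable (fun r => roundEstimate E h r i) (playLaw S (E.graph (actions h)) η L) := by
  rw [roundEstimate_eq_indicator]
  exact (integrable_observed_mul_sum_range hS _ hη hη1 L i (fun _ => zero_le_one)
    (hasSum_resample_pow hη hη1 L _ i)).1.mul_const _

theorem integral_roundEstimate (i : Fin N) :
    ∫ r, roundEstimate E h r i ∂(playLaw S (E.graph (actions h)) η L) =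
      obsProb S (E.graph (actions h)) η L i / resampleRate S (E.graph (actions h)) η L i *
        E.loss (actions h) i := by
  rw [roundEstimate_eq_indicator, integral_mul_const,
    (integrable_observed_mul_sum_range hS _ hη hη1 L i (fun _ => zero_le_one)
    (hasSum_resample_pow hη hη1 L _ i)).2, div_eq_mul_inv]

theorem integrable_roundEstimate_sq (i : Fin N) :
    Integrable (fun r => roundEstimate E h r i ^ 2) (playLaw S (E.graph (actions h)) η L) := by
  obtain ⟨s, -, hs⟩ := exists_hasSum_resample_odd_pow (S := S) hη hη1 L (E.graph (actions h)) i
  rw [roundEstimate_sq_eq_indicator]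
  exact (integrable_observed_mul_sum_range hS _ hη hη1 L i (fun k => by positivity)
    hs).1.mul_const _

variable (hE : ∀ i, E.loss (actions h) i ∈ Set.Icc (0 : ℝ) 1)

include hE

theorem integral_roundEstimate_sq_le (i : Fin N) :
    ∫ r, roundEstimate E h r i ^ 2 ∂(playLaw S (E.graph (actions h)) η L) ≤
      2 / resampleRate S (E.graph (actions h)) η L i := by
  obtain ⟨s, hs2, hs⟩ := exists_hasSum_resample_odd_pow (S := S) hη hη1 L (E.graph (actions h)) i
  have hO := obsProb_nonneg S (E.graph (actions h)) η L i
  have hO2 := obsProb_le_resampleRate (S := S) (E.graph (actions h)) hη.le L i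
  have hO1 := obsProb_le_one S (E.graph (actions h)) η L i
  have hx : 0 ≤ (1 - obsProb S (E.graph (actions h)) η L i) * (1 - η) :=
    mul_nonneg (by linarith) (by linarith)
  have hs0 : 0 ≤ s := hs.nonneg fun k => by positivity
  have hρ := hη.trans_le (le_resampleRate (S := S) (E.graph (actions h)) hη1 L i)
  rw [roundEstimate_sq_eq_indicator, integral_mul_const,
    (integrable_observed_mul_sum_range hS _ hη hη1 L i (fun k => by positivity) hs).2]
  have hl : E.loss (actions h) i ^ 2 ≤ 1 := pow_le_one₀ (hE i).1 (hE i).2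
  refine (mul_le_of_le_one_right (by positivity) hl).trans ?_
  refine (mul_le_mul hO2 hs2 hs0 hρ.le).trans (le_of_eq ?_)
  field_simp

theorem integral_roundEstimate_le_one (i : Fin N) :
    ∫ r, roundEstimate E h r i ∂(playLaw S (E.graph (actions h)) η L) ≤ 1 := by
  rw [integral_roundEstimate hS E h hη hη1 L]
  have hρ := hη.trans_le (le_resampleRate (S := S) (E.graph (actions h)) hη1 L i)
  have hO := obsProb_nonneg S (E.graph (actions h)) η L i
  refine mul_le_one₀ ?_ (hE i).1 (hE i).2
  exact (div_le_one hρ).2 (obsProb_le_resampleRate (S := S) (E.graph (actions h)) hη.le L i)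

omit hE in
theorem integrable_dot_roundEstimate (u : Action N) :
    Integrable (fun r => dot u (roundEstimate E h r)) (playLaw S (E.graph (actions h)) η L) :=
  integrable_finsetSum _ fun i _ => integrable_roundEstimate hS E h hη hη1 L i

omit hE in
theorem integral_dot_roundEstimate (u : Action N) :
    ∫ r, dot u (roundEstimate E h r) ∂(playLaw S (E.graph (actions h)) η L) =
      ∑ i ∈ u, obsProb S (E.graph (actions h)) η L i /
        resampleRate S (E.graph (actions h)) η L i * E.loss (actions h) i := by
  unfold dot
  rw [integral_finsetSum _ fun i _ => integrable_roundEstimate hS E h hη hη1 L i]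
  exact Finset.sum_congr rfl fun i _ => integral_roundEstimate hS E h hη hη1 L i

omit hE in
theorem integrable_dot_roundEstimate_sq (u : Action N) :
    Integrable (fun r => dot u (roundEstimate E h r) ^ 2)
      (playLaw S (E.graph (actions h)) η L) := by
  refine Integrable.mono' ((integrable_finsetSum u fun i _ =>
    integrable_roundEstimate_sq hS E h hη hη1 L i).const_mul u.card)
    measurable_from_top.aestronglyMeasurable (ae_of_all _ fun r => ?_)
  rw [Real.norm_of_nonneg (sq_nonneg _)]
  exact sq_sum_le_card_mul_sum_sq

theorem integral_dot_roundEstimate_sq_le (u : Action N) :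
    ∫ r, dot u (roundEstimate E h r) ^ 2 ∂(playLaw S (E.graph (actions h)) η L) ≤
      u.card * ∑ i ∈ u, 2 / resampleRate S (E.graph (actions h)) η L i := by
  have hi := fun i => integrable_roundEstimate_sq hS E h hη hη1 L i
  have h1 := integral_mono (integrable_dot_roundEstimate_sq hS E h hη hη1 L u)
    ((integrable_finsetSum u fun i _ => hi i).const_mul (u.card : ℝ))
    fun r => sq_sum_le_card_mul_sum_sq (s := u) (f := roundEstimate E h r)
  refine h1.trans ?_
  rw [integral_const_mul, integral_finsetSum _ fun i _ => hi i]
  exact mul_le_mul_of_nonneg_left (Finset.sum_le_sum fun i _ =>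
    integral_roundEstimate_sq_le hS E h hη hη1 L hE i) (Nat.cast_nonneg _)

end Moments

/-! ### Play probabilities against observation probabilities -/

section Observability

variable {N : ℕ} {S : Finset (Action N)}

open Classical in
/-- The probability that the component `i` is played. -/
noncomputable def playProb (S : Finset (Action N)) (η : ℝ) (L : Fin N → ℝ) (i : Fin N) : ℝ :=
  ∑ u, leaderProb S η L u * (if i ∈ u then 1 else 0)

theorem playProb_nonneg (S : Finset (Action N)) (η : ℝ) (L : Fin N → ℝ) (i : Fin N) :
    0 ≤ playProb S η L i := Finset.sum_nonneg fun u _ =>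
  mul_nonneg (leaderProb_nonneg S η L u) (by split_ifs <;> simp)

theorem sum_leaderProb_mul_dot (S : Finset (Action N)) (η : ℝ) (L x : Fin N → ℝ) :
    ∑ u, leaderProb S η L u * dot u x = ∑ i, playProb S η L i * x i := by
  classical
  simp only [playProb, Finset.sum_mul]
  rw [Finset.sum_comm]
  refine Finset.sum_congr rfl fun u _ => ?_
  rw [dot, Finset.mul_sum, ← Finset.sum_filter_add_sum_filter_not Finset.univ (fun i => i ∈ u)]
  rw [Finset.sum_eq_zero (s := Finset.univ.filter fun i => i ∉ u), add_zero]
  · refine Finset.sum_congr (by ext; simp) fun i hi => ?_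
    simp [(Finset.mem_filter.1 hi).2]
  · intro i hi
    simp [(Finset.mem_filter.1 hi).2]

theorem sum_leaderProb_mul_le_obsProb (hS : S.Nonempty) (G : Digraph (Fin N)) (η : ℝ) (L : Fin N → ℝ)
    (i : Fin N) (p : Action N → ℝ) (hp : ∀ u ∈ S, p u ≤ 1) (hp0 : ∀ u, ¬ Observed G u i → p u ≤ 0) :
    ∑ u, leaderProb S η L u * p u ≤ obsProb S G η L i := by
  rw [← integral_apply_perturbedLeader hS]
  have hm := measurableSet_perturbedLeader hS η L (fun u => Observed G u i)
  rw [obsProb, ← integral_indicator_one hm]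
  refine integral_mono (integrable_apply_perturbedLeader hS η L (g := fun u _ => p u)
    fun u => integrable_const _) ((integrable_const _).indicator hm) fun z => ?_
  by_cases hz : Observed G (perturbedLeader S η L z) i
  · rw [Set.indicator_of_mem (by exact hz)]
    exact hp _ (leader_mem hS _)
  · rw [Set.indicator_of_notMem (by exact hz)]
    exact hp0 _ hz

/-- An action has at most `m` components, so the fraction 1/m for each one in the closed
in-neighbourhood of `i` adds up to at most the observation indicator. Dividing by `m` replaces any
independence between components. -/
theorem inWeight_playProb_le (hS : S.Nonempty) {m : ℕ} (hm : 1 ≤ m) (hSm : ∀ v ∈ S, v.card ≤ m)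
    (G : Digraph (Fin N)) (η : ℝ) (L : Fin N → ℝ) (i : Fin N) :
    inWeight G (fun j => playProb S η L j / m) Finset.univ i ≤ obsProb S G η L i := by
  classical
  have hm0 : (0 : ℝ) < m := by exact_mod_cast hm
  have h1 : inWeight G (fun j => playProb S η L j / m) Finset.univ i =
      ∑ u, leaderProb S η L u * dot u (fun j => if j = i ∨ G.Adj j i then (m : ℝ)⁻¹ else 0) := by
    rw [sum_leaderProb_mul_dot, inWeight, Finset.sum_filter]
    refine Finset.sum_congr rfl fun j _ => ?_
    by_cases hj : j = i ∨ G.Adj j i <;> simp [hj, div_eq_mul_inv]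
  rw [h1]
  refine sum_leaderProb_mul_le_obsProb hS G η L i _ (fun u hu => ?_) fun u hu => ?_
  · have : dot u (fun j => if j = i ∨ G.Adj j i then (m : ℝ)⁻¹ else 0) ≤ u.card • (m : ℝ)⁻¹ :=
      Finset.sum_le_card_nsmul _ _ _ fun j _ => by
        dsimp only; split_ifs <;> simp
    refine this.trans ?_
    rw [nsmul_eq_mul, ← div_eq_mul_inv, div_le_one hm0]
    exact_mod_cast hSm u hu
  · refine (Finset.sum_eq_zero fun j hj => if_neg fun hji => hu ?_).le
    rcases hji with rfl | hji
    · exact Or.inl hj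
    · exact Or.inr ⟨j, hj, hji⟩

theorem sum_playProb_le (hS : S.Nonempty) {m : ℕ} (hSm : ∀ v ∈ S, v.card ≤ m) (η : ℝ)
    (L : Fin N → ℝ) : ∑ i, playProb S η L i ≤ m := by
  have h := sum_leaderProb_mul_dot S η L (fun _ => 1)
  simp only [mul_one] at h
  rw [← h]
  calc _ ≤ ∑ u, leaderProb S η L u * m := Finset.sum_le_sum fun u _ => by
        by_cases hu : u ∈ S
        · refine mul_le_mul_of_nonneg_left ?_ (leaderProb_nonneg S η L u)
          simpa [dot] using hSm u hu
        · simp [leaderProb_eq_zero hS η L hu]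
    _ = m := by rw [← Finset.sum_mul, sum_leaderProb hS, one_mul]

theorem one_le_indepNumber (hN : 1 ≤ N) (G : Digraph (Fin N)) : 1 ≤ indepNumber G := by
  have h : G.toSimpleGraphInclusive.IsIndepSet (({⟨0, hN⟩} : Finset (Fin N)) : Set (Fin N)) := by
    simp
  have := h.card_le_indepNum
  rwa [Finset.card_singleton] at this

theorem indepNumber_le (G : Digraph (Fin N)) : indepNumber G ≤ N := by
  obtain ⟨s, hs⟩ := G.toSimpleGraphInclusive.exists_isNIndepSet_indepNum
  have h1 := hs.card_eq
  have h2 := s.card_le_univ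
  rw [Fintype.card_fin] at h2
  exact h1.symm.trans_le h2

/-- Since ρ is at least both o and η, it is at least (o + η)/2, which brings `sum_div_inWeight_le`
into play with c = η. The constant 4m is 2 from this average, m from the rescaled weights, and 2
from the graph bound. -/
theorem sum_playProb_div_resampleRate_le (hS : S.Nonempty) {m : ℕ} (hm : 1 ≤ m)
    (hSm : ∀ v ∈ S, v.card ≤ m) (hN : 1 ≤ N) (G : Digraph (Fin N)) {η : ℝ} (hη : 0 < η)
    (hη1 : η ≤ 1) (L : Fin N → ℝ) :
    ∑ i, playProb S η L i / resampleRate S G η L i ≤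
      4 * m * indepNumber G * Real.log (1 + η⁻¹) := by
  have hm0 : (0 : ℝ) < m := by exact_mod_cast hm
  have hα := one_le_indepNumber hN G
  have hα1 : (1 : ℝ) ≤ indepNumber G := by exact_mod_cast hα
  set w : Fin N → ℝ := fun j => playProb S η L j / m with hw
  have hw0 : ∀ j, 0 ≤ w j := fun j => div_nonneg (playProb_nonneg S η L j) hm0.le
  have h1 : ∀ i ∈ Finset.univ, playProb S η L i / resampleRate S G η L i ≤
      2 * m * (w i / (η + inWeight G w Finset.univ i)) := by
    intro i _
    have e : 2 * m * (w i / (η + inWeight G w Finset.univ i)) =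
        playProb S η L i / ((η + inWeight G w Finset.univ i) / 2) := by
      rw [hw]; field_simp
    rw [e]
    have hW0 := inWeight_nonneg G hw0 Finset.univ i
    have h2 := inWeight_playProb_le hS hm hSm G η L i
    have h3 := obsProb_le_resampleRate (S := S) G hη.le L i
    have h4 := le_resampleRate (S := S) G hη1 L i
    refine div_le_div_of_nonneg_left (playProb_nonneg S η L i) (by positivity) ?_
    linarith
  refine (Finset.sum_le_sum h1).trans ?_
  rw [← Finset.mul_sum]
  have h2 := sum_div_inWeight_le G hw0 hη hα Finset.univ
  have hs0 : 0 ≤ ∑ i, w i := Finset.sum_nonneg fun i _ => hw0 i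
  have hs1 : ∑ i, w i ≤ 1 := by
    rw [hw, ← Finset.sum_div, div_le_one hm0]
    exact sum_playProb_le hS hSm η L
  have h3 : (∑ i, w i) / (2 * indepNumber G * η) ≤ η⁻¹ := by
    rw [div_le_iff₀ (by positivity)]
    have : η⁻¹ * (2 * indepNumber G * η) = 2 * indepNumber G := by field_simp
    linarith
  have h4 : Real.log (1 + (∑ i, w i) / (2 * indepNumber G * η)) ≤ Real.log (1 + η⁻¹) :=
    Real.log_le_log (by positivity) (by linarith)
  calc _ ≤ 2 * m * (2 * indepNumber G * Real.log (1 + η⁻¹)) := by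
        refine mul_le_mul_of_nonneg_left (h2.trans ?_) (by positivity)
        exact mul_le_mul_of_nonneg_left h4 (by positivity)
    _ = _ := by ring

end Observability

/-! ### Histories as a Markov chain and the tower property -/

section History

variable {N m : ℕ} {S : Finset (Action N)} {E : Environment N} {approx : List (Action N) → ℝ}

/-- The kernel that appends one round to a history. -/
noncomputable def historyKernel (m : ℕ) (S : Finset (Action N)) (E : Environment N)
    (approx : List (Action N) → ℝ) : Kernel (List (Round N)) (List (Round N)) :=
  ⟨fun h => (roundLaw m S E approx h).map fun r => r :: h, measurable_from_top⟩

theorem isProbabilityMeasure_roundLaw (hS : S.Nonempty) (h : List (Round N)) :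
    IsProbabilityMeasure (roundLaw m S E approx h) :=
  isProbabilityMeasure_playLaw hS _ _ _

theorem isMarkovKernel_historyKernel (hS : S.Nonempty) :
    IsMarkovKernel (historyKernel m S E approx) :=
  ⟨fun h => by
    have := isProbabilityMeasure_roundLaw (m := m) (E := E) (approx := approx) hS h
    exact Measure.isProbabilityMeasure_map measurable_from_top.aemeasurable⟩

theorem historyLaw_succ (t : ℕ) :
    historyLaw m S E approx (t + 1) =
      (historyLaw m S E approx t).bind (historyKernel m S E approx) := rfl

theorem isProbabilityMeasure_historyLaw (hS : S.Nonempty) (t : ℕ) :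
    IsProbabilityMeasure (historyLaw m S E approx t) := by
  induction t with
  | zero => exact Measure.dirac.isProbabilityMeasure
  | succ t ih =>
    have := isMarkovKernel_historyKernel (m := m) (E := E) (approx := approx) hS
    rw [historyLaw_succ]
    infer_instance

theorem ae_length_historyLaw (t : ℕ) : ∀ᵐ h ∂(historyLaw m S E approx t), h.length = t := by
  induction t with
  | zero =>
    exact (ae_dirac_iff MeasurableSpace.measurableSet_top).2 rfl
  | succ t ih =>
    rw [historyLaw_succ]
    refine Measure.ae_comp_of_ae_ae trivial ?_
    filter_upwards [ih] with h hh
    refine (ae_map_iff measurable_from_top.aemeasurable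
      MeasurableSpace.measurableSet_top).2 (ae_of_all _ fun r => ?_)
    simp [hh]

/-- Sums of increments of nonpositive conditional expectation have nonpositive expectation. -/
theorem integrable_cumulative (hS : S.Nonempty) {D : List (Round N) → Round N → ℝ} {B : ℝ} {T : ℕ}
    (hD : ∀ h : List (Round N), h.length < T → Integrable (D h) (roundLaw m S E approx h) ∧
      ∫ r, |D h r| ∂(roundLaw m S E approx h) ≤ B ∧ ∫ r, D h r ∂(roundLaw m S E approx h) ≤ 0)
    {t : ℕ} (ht : t ≤ T) :
    Integrable (cumulative D) (historyLaw m S E approx t) ∧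
      ∫ h, cumulative D h ∂(historyLaw m S E approx t) ≤ 0 := by
  induction t with
  | zero =>
    refine ⟨integrable_dirac (by simp), ?_⟩
    simp only [historyLaw]
    rw [integral_dirac]
    rfl
  | succ t ih =>
    obtain ⟨hi, hle⟩ := ih (Nat.le_of_succ_le ht)
    have := isMarkovKernel_historyKernel (m := m) (E := E) (approx := approx) hS
    have hpr := isProbabilityMeasure_historyLaw (m := m) (E := E) (approx := approx) hS t
    have hlen := ae_length_historyLaw (m := m) (S := S) (E := E) (approx := approx) t
    have hκ : ∀ (F : List (Round N) → ℝ) (h : List (Round N)),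
        (Integrable F (historyKernel m S E approx h) ↔
          Integrable (fun r => F (r :: h)) (roundLaw m S E approx h)) ∧
        ∫ q, F q ∂(historyKernel m S E approx h) =
          ∫ r, F (r :: h) ∂(roundLaw m S E approx h) := fun F h =>
      ⟨integrable_map_measure measurable_from_top.aestronglyMeasurable
        measurable_from_top.aemeasurable, integral_map measurable_from_top.aemeasurable
        measurable_from_top.aestronglyMeasurable⟩
    have hint : Integrable (cumulative D) (historyLaw m S E approx (t + 1)) := by
      rw [historyLaw_succ, Measure.integrable_comp_iff measurable_from_top.aestronglyMeasurable]
      constructor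
      · filter_upwards [hlen] with h hh
        have := isProbabilityMeasure_roundLaw (m := m) (E := E) (approx := approx) hS h
        rw [(hκ _ h).1]
        exact (integrable_const _).add (hD h (by omega)).1
      -- The counts are unbounded, so increments are not bounded pointwise; the uniform bound `B` on
      -- their conditional L¹ norms is what carries integrability to the next round.
      · refine Integrable.mono' (hi.norm.add (integrable_const B))
          measurable_from_top.aestronglyMeasurable ?_
        filter_upwards [hlen] with h hh
        have := isProbabilityMeasure_roundLaw (m := m) (E := E) (approx := approx) hS h
        obtain ⟨h1, h2, -⟩ := hD h (by omega)
        rw [Real.norm_of_nonneg (integral_nonneg fun _ => norm_nonneg _), (hκ _ h).2]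
        have h3 : ∫ r, ‖cumulative D (r :: h)‖ ∂(roundLaw m S E approx h) ≤
            ∫ r, (|cumulative D h| + |D h r|) ∂(roundLaw m S E approx h) :=
          integral_mono ((integrable_const (cumulative D h)).add h1).norm
            ((integrable_const _).add h1.abs) fun r => abs_add_le _ _
        rw [integral_add (integrable_const _) h1.abs, integral_const] at h3
        simp only [probReal_univ, one_smul] at h3
        exact h3.trans (add_le_add le_rfl h2)
    refine ⟨hint, ?_⟩
    rw [historyLaw_succ] at hint ⊢
    rw [Measure.comp_eq_comp_const_apply] at hint ⊢
    rw [Kernel.integral_comp hint, Kernel.const_apply]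
    have hint' := hint.integral_comp
    rw [Kernel.const_apply] at hint'
    refine le_trans (integral_mono_ae hint' hi ?_) hle
    filter_upwards [hlen] with h hh
    have := isProbabilityMeasure_roundLaw (m := m) (E := E) (approx := approx) hS h
    obtain ⟨h1, -, h2⟩ := hD h (by omega)
    rw [(hκ _ h).2]
    have h3 : ∫ r, cumulative D (r :: h) ∂(roundLaw m S E approx h) =
        ∫ r, (cumulative D h + D h r) ∂(roundLaw m S E approx h) := rfl
    rw [h3, integral_add (integrable_const _) h1, integral_const]
    simp only [probReal_univ, one_smul]
    linarith

/-- There are only finitely many action sequences of length `t`, so `g` is almost surely bounded. -/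
theorem integrable_comp_actions (hS : S.Nonempty) (g : List (Action N) → ℝ) (t : ℕ) :
    Integrable (fun h => g (actions h)) (historyLaw m S E approx t) := by
  have hpr := isProbabilityMeasure_historyLaw (m := m) (E := E) (approx := approx) hS t
  have hfin : {a : List (Action N) | a.length = t}.Finite := List.finite_length_eq _ _
  refine Integrable.of_bound (C := ∑ a ∈ hfin.toFinset, ‖g a‖)
    measurable_from_top.aestronglyMeasurable ?_
  filter_upwards [ae_length_historyLaw (m := m) (S := S) (E := E) (approx := approx) t] with h hh
  refine Finset.single_le_sum (f := fun a => ‖g a‖) (fun _ _ => norm_nonneg _) ?_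
  simp [actions, hh]

end History

/-! ### Conditional expectation of one round of regret -/

section Increment

variable {N : ℕ}

/-- The regret of one round, minus its estimate and minus a compensator. -/
noncomputable def regretIncrement (m : ℕ) (S : Finset (Action N)) (E : Environment N)
    (approx : List (Action N) → ℝ) (v : Action N) (f : List (Action N) → ℝ) (h : List (Round N))
    (r : Round N) : ℝ :=
  dot r.action (E.loss (actions h)) - dot v (E.loss (actions h)) -
    estimatedGap m S E approx v h r - f (actions h)

theorem cumulative_regretIncrement (m : ℕ) (S : Finset (Action N)) (E : Environment N)
    (approx : List (Action N) → ℝ) (v : Action N) (f : List (Action N) → ℝ) (h : List (Round N)) :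
    cumulative (regretIncrement m S E approx v f) h = excessLoss E v (actions h) -
      cumulative (estimatedGap m S E approx v) h - sumPast f (actions h) := by
  induction h with
  | nil => simp [cumulative, actions, excessLoss, sumPast]
  | cons r h ih =>
    have e1 : excessLoss E v (actions (r :: h)) = excessLoss E v (actions h) +
      (dot r.action (E.loss (actions h)) - dot v (E.loss (actions h))) := rfl
    have e2 : sumPast f (actions (r :: h)) = sumPast f (actions h) + f (actions h) := rfl
    rw [e1, e2]
    simp only [cumulative, ih, regretIncrement]
    ring

variable {m : ℕ} {S : Finset (Action N)} (hS : S.Nonempty) {E : Environment N}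
  {approx : List (Action N) → ℝ} {h : List (Round N)} (hη : 0 < rate m approx (actions h))
  (hη1 : rate m approx (actions h) ≤ 1)

include hS hη hη1

theorem integrable_estimatedGap (v : Action N) :
    Integrable (estimatedGap m S E approx v h) (roundLaw m S E approx h) := by
  have h1 := integrable_dot_roundEstimate hS E h hη hη1 (lossEstimate E h)
  have h2 := integrable_dot_roundEstimate_sq hS E h hη hη1 (lossEstimate E h)
  exact (integrable_finsetSum _ fun u _ => ((h1 u).sub ((h2 u).const_mul _)).const_mul _).sub (h1 v)

theorem integrable_regretIncrement (v : Action N) (f : List (Action N) → ℝ) :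
    Integrable (regretIncrement m S E approx v f h) (roundLaw m S E approx h) := by
  have := isProbabilityMeasure_roundLaw (m := m) (E := E) (approx := approx) hS h
  refine Integrable.sub (Integrable.sub (Integrable.sub ?_ (integrable_const _))
    (integrable_estimatedGap hS hη hη1 v)) (integrable_const _)
  refine Integrable.of_bound (C := ∑ u : Action N, ‖dot u (E.loss (actions h))‖)
    measurable_from_top.aestronglyMeasurable (ae_of_all _ fun r => ?_)
  exact Finset.single_le_sum (f := fun u : Action N => ‖dot u (E.loss (actions h))‖)
    (fun _ _ => norm_nonneg _) (Finset.mem_univ _)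

variable (hE : ∀ i, E.loss (actions h) i ∈ Set.Icc (0 : ℝ) 1)

include hE

/-- The coefficient 2m comes from the quadratic correction, by Cauchy-Schwarz on at most `m`
components and the second moment 2/ρ; the extra 1 is the bias. -/
theorem integral_regretIncrement_le (hSm : ∀ v ∈ S, v.card ≤ m) (v : Action N)
    (f : List (Action N) → ℝ) :
    ∫ r, regretIncrement m S E approx v f h r ∂(roundLaw m S E approx h) ≤
      (2 * m + 1) * rate m approx (actions h) * ∑ i,
        playProb S (rate m approx (actions h)) (lossEstimate E h) i /
          resampleRate S (E.graph (actions h)) (rate m approx (actions h)) (lossEstimate E h) i -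
        f (actions h) := by
  have hpr := isProbabilityMeasure_roundLaw (m := m) (E := E) (approx := approx) hS h
  set η := rate m approx (actions h) with hη_def
  set G := E.graph (actions h) with hG
  set L := lossEstimate E h with hL
  set l := E.loss (actions h) with hl
  have hlaw : roundLaw m S E approx h = playLaw S G η L := rfl
  have h1 := integrable_dot_roundEstimate hS E h hη hη1 L
  have h2 := integrable_dot_roundEstimate_sq hS E h hη hη1 L
  have e1 := integral_dot_roundEstimate hS E h hη hη1 L
  have e2 := integral_dot_roundEstimate_sq_le hS E h hη hη1 L hE
  have hρ : ∀ i, 0 < resampleRate S G η L i := fun i => hη.trans_le (le_resampleRate G hη1 L i)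
  have hO := obsProb_nonneg S G η L
  have hOρ := obsProb_le_resampleRate (S := S) G hη.le L
  set b : Fin N → ℝ := fun i => obsProb S G η L i / resampleRate S G η L i * l i with hb
  set ρ := resampleRate S G η L with hρ_def
  have hgap : ∑ u, leaderProb S η L u * (dot u b - η * (m * dot u fun i => 2 / ρ i)) - dot v b ≤
      ∫ r, estimatedGap m S E approx v h r ∂(roundLaw m S E approx h) := by
    have i1 : ∀ u, Integrable (fun r => leaderProb S η L u * (dot u (roundEstimate E h r) -
        η * dot u (roundEstimate E h r) ^ 2)) (playLaw S G η L) := fun u =>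
      ((h1 u).sub ((h2 u).const_mul _)).const_mul _
    have i2 : Integrable (fun r => ∑ u, leaderProb S η L u * (dot u (roundEstimate E h r) -
        η * dot u (roundEstimate E h r) ^ 2)) (playLaw S G η L) :=
      integrable_finsetSum _ fun u _ => i1 u
    unfold estimatedGap
    rw [hlaw, integral_sub i2 (h1 v), integral_finsetSum _ fun u _ => i1 u, e1 v]
    refine sub_le_sub_right (Finset.sum_le_sum fun u _ => ?_) _
    rw [integral_const_mul]
    by_cases hu : u ∈ S
    · refine mul_le_mul_of_nonneg_left ?_ (leaderProb_nonneg S η L u)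
      rw [integral_sub (h1 u) ((h2 u).const_mul _), integral_const_mul, e1 u]
      refine sub_le_sub_left (mul_le_mul_of_nonneg_left ((e2 u).trans ?_) hη.le) _
      refine mul_le_mul_of_nonneg_right (by exact_mod_cast hSm u hu) ?_
      exact dot_nonneg u fun i => (div_pos two_pos (hρ i)).le
    · rw [leaderProb_eq_zero hS η L hu]; simp
  -- For the comparator the bias is favourable: its loss is underestimated on average, so it costs
  -- nothing.
  have hbl : dot v b ≤ dot v l := Finset.sum_le_sum fun i _ =>
    mul_le_of_le_one_left (hE i).1 ((div_le_one (hρ i)).2 (hOρ i))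
  have hact : Integrable (fun r : Round N => dot r.action l) (roundLaw m S E approx h) := by
    refine Integrable.of_bound (C := ∑ u : Action N, ‖dot u l‖)
      measurable_from_top.aestronglyMeasurable (ae_of_all _ fun r => ?_)
    exact Finset.single_le_sum (f := fun u : Action N => ‖dot u l‖)
      (fun _ _ => norm_nonneg _) (Finset.mem_univ _)
  have hsplit : ∫ r, regretIncrement m S E approx v f h r ∂(roundLaw m S E approx h) =
      ∑ u, leaderProb S η L u * dot u l - dot v l -
        ∫ r, estimatedGap m S E approx v h r ∂(roundLaw m S E approx h) - f (actions h) := by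
    have i3 := integrable_estimatedGap (E := E) hS hη hη1 v
    have i4 : Integrable (fun r : Round N => dot r.action l - dot v l)
      (roundLaw m S E approx h) := hact.sub (integrable_const _)
    have i5 : Integrable (fun r : Round N => dot r.action l - dot v l -
      estimatedGap m S E approx v h r) (roundLaw m S E approx h) := i4.sub i3
    unfold regretIncrement
    rw [integral_sub i5 (integrable_const _), integral_sub i4 i3,
      integral_sub hact (integrable_const _),
      ← integral_action_playLaw hS G η L (fun u => dot u l)]
    simp only [integral_const, probReal_univ, one_smul]
    rfl
  rw [hsplit]
  have hcomb : ∑ u, leaderProb S η L u * dot u l -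
      ∑ u, leaderProb S η L u * (dot u b - η * (m * dot u fun i => 2 / ρ i)) =
      ∑ i, playProb S η L i * (l i - b i + η * (m * (2 / ρ i))) := by
    rw [← sum_leaderProb_mul_dot, ← Finset.sum_sub_distrib]
    refine Finset.sum_congr rfl fun u _ => ?_
    rw [← mul_sub]
    congr 1
    simp only [dot, Finset.sum_add_distrib, Finset.sum_sub_distrib, Finset.mul_sum]
    ring
  have hfin : ∑ i, playProb S η L i * (l i - b i + η * (m * (2 / ρ i))) ≤
      (2 * m + 1) * η * ∑ i, playProb S η L i / ρ i := by
    rw [Finset.mul_sum]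
    refine Finset.sum_le_sum fun i _ => ?_
    -- The bias is ℓ (ρ - o)/ρ, and ρ - o = η (1 - o) ≤ η.
    have h3 : l i - b i ≤ η / ρ i := by
      have : l i - b i = l i * (ρ i - obsProb S G η L i) / ρ i := by
        have := (hρ i).ne'
        simp only [hb]
        field_simp
      rw [this]
      refine div_le_div_of_nonneg_right ?_ (hρ i).le
      refine (mul_le_of_le_one_left (sub_nonneg.2 (hOρ i)) (hE i).2).trans ?_
      have := mul_nonneg (hO i) hη.le
      have hd : ρ i = 1 - (1 - obsProb S G η L i) * (1 - η) := rfl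
      rw [hd]
      linarith
    calc _ ≤ playProb S η L i * (η / ρ i + η * (m * (2 / ρ i))) :=
          mul_le_mul_of_nonneg_left (by linarith) (playProb_nonneg S η L i)
      _ = _ := by ring
  linarith

/-- Used only for integrability, so the size is irrelevant. Uniformity in the history comes from ρ ≥
η, which cancels the factor η against the second moment 2/ρ. -/
theorem integral_abs_regretIncrement_le (v : Action N)
    {f : List (Action N) → ℝ} {B : ℝ} (hf : |f (actions h)| ≤ B) :
    ∫ r, |regretIncrement m S E approx v f h r| ∂(roundLaw m S E approx h) ≤
      3 * N + 2 * N ^ 2 + B := by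
  have hpr := isProbabilityMeasure_roundLaw (m := m) (E := E) (approx := approx) hS h
  set η := rate m approx (actions h) with hη_def
  set G := E.graph (actions h) with hG
  set L := lossEstimate E h with hL
  set l := E.loss (actions h) with hl
  have hlaw : roundLaw m S E approx h = playLaw S G η L := rfl
  have h1 := integrable_dot_roundEstimate hS E h hη hη1 L
  have h2 := integrable_dot_roundEstimate_sq hS E h hη hη1 L
  have hcard : ∀ u : Action N, (u.card : ℝ) ≤ N := fun u => by
    have := u.card_le_univ
    rw [Fintype.card_fin] at this
    exact_mod_cast this
  have e1 : ∀ u, ∫ r, dot u (roundEstimate E h r) ∂(roundLaw m S E approx h) ≤ N := fun u => by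
    unfold dot
    rw [hlaw, integral_finsetSum _ fun i _ => integrable_roundEstimate hS E h hη hη1 L i]
    have := Finset.sum_le_card_nsmul u _ (1 : ℝ) fun i _ =>
      integral_roundEstimate_le_one hS E h hη hη1 L hE i
    rw [nsmul_eq_mul, mul_one] at this
    exact this.trans (hcard u)
  have e2 : ∀ u, ∫ r, η * dot u (roundEstimate E h r) ^ 2 ∂(roundLaw m S E approx h) ≤
      2 * N ^ 2 := fun u => by
    rw [integral_const_mul]
    have h3 := integral_dot_roundEstimate_sq_le hS E h hη hη1 L hE u
    have h4 : ∑ i ∈ u, 2 / resampleRate S G η L i ≤ u.card • (2 / η) :=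
      Finset.sum_le_card_nsmul _ _ _ fun i _ =>
        div_le_div_of_nonneg_left two_pos.le hη (le_resampleRate G hη1 L i)
    rw [nsmul_eq_mul] at h4
    have hc := hcard u
    have hc0 : (0 : ℝ) ≤ u.card := Nat.cast_nonneg _
    calc _ ≤ η * (u.card * (u.card * (2 / η))) := by
          refine mul_le_mul_of_nonneg_left (h3.trans ?_) hη.le
          exact mul_le_mul_of_nonneg_left h4 hc0
      _ = 2 * (u.card : ℝ) ^ 2 := by field_simp
      _ ≤ _ := by gcongr
  have hdot : ∀ u : Action N, 0 ≤ dot u l ∧ dot u l ≤ N := fun u => by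
    refine ⟨dot_nonneg u fun i => (hE i).1, ?_⟩
    have := Finset.sum_le_card_nsmul u l (1 : ℝ) fun i _ => (hE i).2
    rw [nsmul_eq_mul, mul_one] at this
    exact this.trans (hcard u)
  have hx0 : ∀ r i, 0 ≤ roundEstimate E h r i := fun r i =>
    roundEstimate_nonneg (fun i => (hE i).1) r i
  have hterm : ∀ u, Integrable (fun r => leaderProb S η L u * (dot u (roundEstimate E h r) +
      η * dot u (roundEstimate E h r) ^ 2)) (roundLaw m S E approx h) := fun u =>
    ((h1 u).add ((h2 u).const_mul _)).const_mul _
  have hle : ∀ r, |regretIncrement m S E approx v f h r| ≤ (N + B) +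
      (∑ u, leaderProb S η L u * (dot u (roundEstimate E h r) +
        η * dot u (roundEstimate E h r) ^ 2) + dot v (roundEstimate E h r)) := by
    intro r
    have hg : |estimatedGap m S E approx v h r| ≤
        ∑ u, leaderProb S η L u * (dot u (roundEstimate E h r) +
        η * dot u (roundEstimate E h r) ^ 2) + dot v (roundEstimate E h r) := by
      unfold estimatedGap
      refine (abs_sub _ _).trans ?_
      rw [abs_of_nonneg (dot_nonneg v (hx0 r))]
      refine add_le_add ((Finset.abs_sum_le_sum_abs _ _).trans (Finset.sum_le_sum fun u _ => ?_))
        le_rfl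
      rw [abs_mul, abs_of_nonneg (leaderProb_nonneg _ _ _ _)]
      refine mul_le_mul_of_nonneg_left ?_ (leaderProb_nonneg _ _ _ _)
      refine (abs_sub _ _).trans ?_
      rw [abs_of_nonneg (dot_nonneg u (hx0 r)), abs_of_nonneg (by positivity)]
    have h3 : |dot r.action l - dot v l| ≤ N := by
      rw [abs_le]
      constructor <;> linarith [hdot r.action, hdot v]
    unfold regretIncrement
    refine (abs_sub _ _).trans ?_
    have := abs_sub (dot r.action l - dot v l) (estimatedGap m S E approx v h r)
    linarith
  have i1 : Integrable (fun r => ∑ u, leaderProb S η L u * (dot u (roundEstimate E h r) +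
      η * dot u (roundEstimate E h r) ^ 2)) (roundLaw m S E approx h) :=
    integrable_finsetSum _ fun u _ => hterm u
  have i2 : Integrable (fun r => ∑ u, leaderProb S η L u * (dot u (roundEstimate E h r) +
      η * dot u (roundEstimate E h r) ^ 2) + dot v (roundEstimate E h r))
      (roundLaw m S E approx h) := i1.add (h1 v)
  have i3 : Integrable (fun r => (N + B) + (∑ u, leaderProb S η L u *
      (dot u (roundEstimate E h r) + η * dot u (roundEstimate E h r) ^ 2) +
      dot v (roundEstimate E h r))) (roundLaw m S E approx h) := (integrable_const _).add i2
  refine (integral_mono (integrable_regretIncrement hS hη hη1 v f).abs i3 hle).trans ?_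
  rw [integral_add (integrable_const _) i2, integral_add i1 (h1 v),
    integral_finsetSum _ fun u _ => hterm u, integral_const]
  simp only [probReal_univ, one_smul]
  have h5 : ∑ u, ∫ r, leaderProb S η L u * (dot u (roundEstimate E h r) +
      η * dot u (roundEstimate E h r) ^ 2) ∂(roundLaw m S E approx h) ≤
      ∑ u, leaderProb S η L u * (N + 2 * (N : ℝ) ^ 2) := by
    refine Finset.sum_le_sum fun u _ => ?_
    rw [integral_const_mul]
    refine mul_le_mul_of_nonneg_left ?_ (leaderProb_nonneg _ _ _ _)
    rw [hlaw, integral_add (h1 u) ((h2 u).const_mul _)]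
    exact add_le_add (e1 u) (e2 u)
  rw [← Finset.sum_mul, sum_leaderProb hS, one_mul] at h5
  linarith [e1 v]

end Increment

/-! ### Sums over past rounds and the adaptive parameter -/

section Rate

variable {N : ℕ}

theorem sumPast_le_sumPast {f g : List (Action N) → ℝ} {T : ℕ}
    (hfg : ∀ a : List (Action N), a.length < T → f a ≤ g a) {a : List (Action N)}
    (ha : a.length ≤ T) : sumPast f a ≤ sumPast g a := by
  induction a with
  | nil => exact le_rfl
  | cons u a ih => exact add_le_add (ih (Nat.le_of_succ_le ha)) (hfg a ha)

theorem sumPast_const (c : ℝ) (a : List (Action N)) : sumPast (fun _ => c) a = a.length * c := by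
  induction a with
  | nil => simp [sumPast]
  | cons u a ih => simp only [sumPast, ih, List.length_cons]; push_cast; ring

theorem sumPast_const_mul (c : ℝ) (f : List (Action N) → ℝ) (a : List (Action N)) :
    sumPast (fun b => c * f b) a = c * sumPast f a := by
  induction a with
  | nil => simp [sumPast]
  | cons u a ih => simp only [sumPast, ih]; ring

theorem sumPast_nonneg {f : List (Action N) → ℝ} {T : ℕ}
    (hf : ∀ a : List (Action N), a.length < T → 0 ≤ f a) {a : List (Action N)}
    (ha : a.length ≤ T) : 0 ≤ sumPast f a := by
  have := sumPast_le_sumPast hf ha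
  rwa [sumPast_const, mul_zero] at this

theorem sumPast_eq_sum_Icc {f : List (Action N) → ℝ} {α : ℕ → ℝ} {T : ℕ}
    (hf : ∀ a : List (Action N), a.length < T → f a = α (a.length + 1)) {a : List (Action N)}
    (ha : a.length ≤ T) : sumPast f a = ∑ t ∈ Finset.Icc 1 a.length, α t := by
  induction a with
  | nil => simp [sumPast]
  | cons u a ih =>
    rw [List.length_cons, Finset.sum_Icc_succ_top (by omega), ← ih (Nat.le_of_succ_le ha),
      ← hf a ha]
    rfl

variable {m : ℕ} {approx : List (Action N) → ℝ} {a : List (Action N)}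

theorem rate_pos (hm : 1 ≤ m) (hN : 1 ≤ N) (h : 0 ≤ sumPast approx a) : 0 < rate m approx a := by
  have hm0 : (0 : ℝ) < m := by exact_mod_cast hm
  have hN0 : (0 : ℝ) < N := by exact_mod_cast hN
  have := Real.log_natCast_nonneg N
  unfold rate
  positivity

theorem rate_le_one (hm : 1 ≤ m) (hN : 1 ≤ N) (h : 0 ≤ sumPast approx a) :
    rate m approx a ≤ 1 := by
  have hm0 : (1 : ℝ) ≤ m := by exact_mod_cast hm
  have hN0 : (0 : ℝ) < N := by exact_mod_cast hN
  have hl := Real.log_le_sub_one_of_pos hN0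
  unfold rate
  rw [Real.sqrt_le_one, div_le_one (by positivity)]
  nlinarith

theorem rate_cons_le (hm : 1 ≤ m) (hN : 1 ≤ N) (h : 0 ≤ sumPast approx a) (ha : 0 ≤ approx a)
    (u : Action N) : rate m approx (u :: a) ≤ rate m approx a := by
  have hm0 : (0 : ℝ) < m := by exact_mod_cast hm
  have hN0 : (0 : ℝ) < N := by exact_mod_cast hN
  have := Real.log_natCast_nonneg N
  unfold rate
  refine Real.sqrt_le_sqrt (div_le_div_of_nonneg_left (by positivity) (by positivity) ?_)
  simp only [sumPast]
  gcongr
  linarith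

theorem inv_rate_le (hm : 1 ≤ m) (hN : 1 ≤ N) {X : ℝ} (h : 0 ≤ sumPast approx a)
    (hX : m * (N + sumPast approx a) ≤ X) : (rate m approx a)⁻¹ ≤ X := by
  have hm0 : (1 : ℝ) ≤ m := by exact_mod_cast hm
  have hN0 : (1 : ℝ) ≤ N := by exact_mod_cast hN
  have hl := Real.log_natCast_nonneg N
  have hD : 1 ≤ m * (N + sumPast approx a) := by nlinarith
  have hX0 : 1 ≤ X := hD.trans hX
  refine inv_le_of_inv_le₀ (by positivity) (Real.le_sqrt_of_sq_le ?_)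
  calc X⁻¹ ^ 2 ≤ X⁻¹ := by
        rw [sq]
        exact mul_le_of_le_one_left (by positivity) (inv_le_one_of_one_le₀ hX0)
    _ ≤ (m * (N + sumPast approx a))⁻¹ := inv_anti₀ (by positivity) hX
    _ ≤ _ := by
      rw [inv_eq_one_div]
      exact div_le_div_of_nonneg_right (by linarith) (by positivity)

theorem natCast_rpow_three_halves (m : ℕ) : (m : ℝ) ^ (3 / 2 : ℝ) = m * Real.sqrt m := by
  rcases Nat.eq_zero_or_pos m with rfl | hm
  · simp
  · have hm0 : (0 : ℝ) < m := by exact_mod_cast hm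
    rw [show (3 / 2 : ℝ) = 1 + 1 / 2 by norm_num, Real.rpow_add hm0, Real.rpow_one,
      Real.sqrt_eq_rpow]

theorem inv_rate_mul_eq (hm : 1 ≤ m) (hN : 1 ≤ N) (h : 0 ≤ sumPast approx a) :
    (rate m approx a)⁻¹ * (m * (Real.log N + 1)) =
      (m : ℝ) ^ (3 / 2 : ℝ) * Real.sqrt ((N + sumPast approx a) * (Real.log N + 1)) := by
  have hm0 : (0 : ℝ) < m := by exact_mod_cast hm
  have hN0 : (0 : ℝ) < N := by exact_mod_cast hN
  have hl := Real.log_natCast_nonneg N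
  set K := Real.log N + 1 with hK
  have hK0 : 0 < K := by positivity
  set D := N + sumPast approx a with hD
  have hD0 : 0 < D := by positivity
  have hKs := Real.sqrt_ne_zero'.2 hK0
  rw [natCast_rpow_three_halves, rate, ← hK, ← hD, Real.sqrt_div hK0.le, Real.sqrt_mul hm0.le,
    Real.sqrt_mul hD0.le, inv_div]
  field_simp
  rw [Real.sq_sqrt hK0.le]

/-- The adaptive-step estimate ∑ a_t/√(a_1 + ⋯ + a_t) ≤ 2 √(∑ a_t), adapted to a parameter that
knows only approximations of earlier terms. -/
theorem sumPast_rate_mul_le (hm : 1 ≤ m) (hN : 1 ≤ N) {C : ℝ} (hC : 1 ≤ C)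
    {α : List (Action N) → ℝ} {T : ℕ}
    (hα : ∀ a : List (Action N), a.length < T → 0 < α a ∧ α a ≤ N ∧ α a ≤ C * approx a)
    {a : List (Action N)} (ha : a.length ≤ T) :
    sumPast (fun a => rate m approx a * α a) a ≤
      2 * Real.sqrt ((Real.log N + 1) / m * (C * sumPast α a)) := by
  have hm0 : (0 : ℝ) < m := by exact_mod_cast hm
  have hN0 : (0 : ℝ) < N := by exact_mod_cast hN
  have hl := Real.log_natCast_nonneg N
  have hC0 : 0 < C := by linarith
  induction a with
  | nil => simp [sumPast]
  | cons u a ih =>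
    have ih := ih (Nat.le_of_succ_le ha)
    obtain ⟨h1, h2, h3⟩ := hα a ha
    have hA0 : 0 ≤ sumPast α a := sumPast_nonneg (fun b hb => (hα b hb).1.le)
      (Nat.le_of_succ_le ha)
    have hAC : sumPast α a ≤ C * sumPast approx a := by
      rw [← sumPast_const_mul]
      exact sumPast_le_sumPast (fun b hb => (hα b hb).2.2) (Nat.le_of_succ_le ha)
    have e1 : sumPast (fun a => rate m approx a * α a) (u :: a) =
      sumPast (fun a => rate m approx a * α a) a + rate m approx a * α a := rfl
    have e2 : sumPast α (u :: a) = sumPast α a + α a := rfl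
    rw [e1, e2]
    set A := sumPast α a
    set D := (N : ℝ) + sumPast approx a with hD
    -- The summand N in the parameter pays for the current term, which the parameter has not seen
    -- yet: α ≤ N ≤ CN.
    have hDA : A + α a ≤ C * D := by
      have : (N : ℝ) ≤ C * N := le_mul_of_one_le_left hN0.le hC
      rw [hD, mul_add]; linarith
    have hD0 : 0 < D := by
      by_contra! hneg
      have := mul_nonpos_of_nonneg_of_nonpos hC0.le hneg
      linarith
    set κ := (Real.log N + 1) / m with hκ
    have hκ0 : 0 < κ := by positivity
    set s := Real.sqrt (κ * (C * (A + α a))) with hs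
    set s₀ := Real.sqrt (κ * (C * A)) with hs₀
    have hspos : 0 < s := Real.sqrt_pos.2 (by positivity)
    have hsq : s ^ 2 = κ * (C * (A + α a)) := Real.sq_sqrt (by positivity)
    have hsq₀ : s₀ ^ 2 = κ * (C * A) := Real.sq_sqrt (by positivity)
    have hrs : rate m approx a * s ≤ κ * C := by
      rw [rate, hs, ← Real.sqrt_mul' _ (by positivity)]
      refine Real.sqrt_le_iff.2 ⟨by positivity, ?_⟩
      rw [← hD, show (Real.log N + 1) / (m * D) = κ / D by rw [hκ, div_div], div_mul_eq_mul_div,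
        div_le_iff₀ hD0]
      have := mul_le_mul_of_nonneg_left hDA (show 0 ≤ κ * κ * C by positivity)
      linarith
    have h4 := mul_le_mul_of_nonneg_right hrs h1.le
    -- The left side is at most κCα = s² - s₀², and s² - s₀² ≤ 2(s - s₀)s since the difference is (s
    -- - s₀)².
    have h5 : rate m approx a * α a * s ≤ 2 * (s - s₀) * s := by
      nlinarith [sq_nonneg (s - s₀)]
    have := le_of_mul_le_mul_right h5 hspos
    linarith

end Rate

/-! ### Assembling the regret bound -/

section Regret

variable {N m T : ℕ} {S : Finset (Action N)} {E : Environment N}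
  {approx : List (Action N) → ℝ} {C : ℝ}

/-- The regret bound against a fixed action. -/
theorem integral_excessLoss_le (hm : 1 ≤ m) (hT : 1 ≤ T) (hmN : 4 < m * N) (hS : S.Nonempty)
    (hSm : ∀ v ∈ S, v.card ≤ m) (hC : 1 < C)
    (hE : ∀ a : List (Action N), a.length < T → ∀ i, E.loss a i ∈ Set.Icc (0 : ℝ) 1)
    (happrox : ∀ a : List (Action N), a.length < T →
      (indepNumber (E.graph a) : ℝ) / C ≤ approx a ∧ approx a ≤ indepNumber (E.graph a))
    {v : Action N} (hv : v ∈ S) :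
    ∫ h, excessLoss E v (actions h) ∂(historyLaw m S E approx T) ≤
      49 * Real.log ((m : ℝ) * N * T) * (m : ℝ) ^ (3 / 2 : ℝ) *
        ∫ h, Real.sqrt ((N + C * sumPast (fun a => (indepNumber (E.graph a) : ℝ)) (actions h)) *
          (Real.log N + 1)) ∂(historyLaw m S E approx T) := by
  have hN : 1 ≤ N := by
    rcases Nat.eq_zero_or_pos N with rfl | h
    · simp at hmN
    · exact h
  have hm1 : (1 : ℝ) ≤ m := by exact_mod_cast hm
  have hN1 : (1 : ℝ) ≤ N := by exact_mod_cast hN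
  have hT1 : (1 : ℝ) ≤ T := by exact_mod_cast hT
  have hC0 : 0 < C := by linarith
  have hl := Real.log_natCast_nonneg N
  set X : ℝ := (m : ℝ) * N * T with hX
  -- Here mN > 4 enters: X ≥ 5 > e gives Λ ≥ 1, so terms without a logarithm can be absorbed, and 1
  -- + X ≤ X² gives log(1 + X) ≤ 2Λ.
  have hX5 : 5 ≤ X := by
    have h5 : (5 : ℝ) ≤ (m : ℝ) * N := by exact_mod_cast hmN
    rw [hX]
    nlinarith
  set Λ := Real.log X with hΛ
  have hΛ1 : 1 ≤ Λ := by
    rw [hΛ, Real.le_log_iff_exp_le (by linarith)]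
    linarith [Real.exp_one_lt_d9]
  have hlogX : Real.log (1 + X) ≤ 2 * Λ := by
    rw [hΛ, ← Real.log_rpow (by linarith) 2]
    refine Real.log_le_log (by linarith) ?_
    rw [Real.rpow_two]
    nlinarith
  set α : List (Action N) → ℝ := fun a => (indepNumber (E.graph a) : ℝ) with hα
  have hα1 : ∀ a, 1 ≤ α a := fun a => by
    simpa [hα] using one_le_indepNumber hN (E.graph a)
  have hαN : ∀ a, α a ≤ N := fun a => by
    simpa [hα] using indepNumber_le (E.graph a)
  have hαC : ∀ a : List (Action N), a.length < T → α a ≤ C * approx a := fun a ha => by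
    have := (happrox a ha).1
    rwa [div_le_iff₀ hC0, mul_comm] at this
  have hap0 : ∀ a : List (Action N), a.length < T → 0 ≤ approx a := fun a ha =>
    le_trans (div_nonneg (Nat.cast_nonneg _) hC0.le) (happrox a ha).1
  have hsum0 : ∀ {a : List (Action N)}, a.length ≤ T → 0 ≤ sumPast approx a := fun ha =>
    sumPast_nonneg hap0 ha
  have hpos : ∀ a : List (Action N), a.length ≤ T → 0 < rate m approx a := fun a ha =>
    rate_pos hm hN (hsum0 ha)
  have hone : ∀ a : List (Action N), a.length ≤ T → rate m approx a ≤ 1 := fun a ha =>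
    rate_le_one hm hN (hsum0 ha)
  have hinv : ∀ a : List (Action N), a.length < T → (rate m approx a)⁻¹ ≤ X := fun a ha => by
    refine inv_rate_le hm hN (hsum0 ha.le) ?_
    have h1 : sumPast approx a ≤ a.length * N := by
      rw [← sumPast_const]
      exact sumPast_le_sumPast (fun b hb => (happrox b hb).2.trans (hαN b)) ha.le
    have h2 : (a.length : ℝ) + 1 ≤ T := by exact_mod_cast ha
    have h3 : N + sumPast approx a ≤ N * T := by nlinarith
    rw [hX, mul_assoc]
    exact mul_le_mul_of_nonneg_left h3 (by linarith)
  -- The compensator is the one-round bound: 2m + 1 ≤ 3m, times 4mα, times 2Λ, times the parameter.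
  set f : List (Action N) → ℝ := fun a => 24 * (m : ℝ) ^ 2 * Λ * (rate m approx a * α a) with hf
  have hlen : ∀ h : List (Round N), (actions h).length = h.length := fun h => List.length_map _
  have hD : ∀ h : List (Round N), h.length < T →
      Integrable (regretIncrement m S E approx v f h) (roundLaw m S E approx h) ∧
      ∫ r, |regretIncrement m S E approx v f h r| ∂(roundLaw m S E approx h) ≤
        3 * N + 2 * N ^ 2 + 24 * (m : ℝ) ^ 2 * Λ * N ∧
      ∫ r, regretIncrement m S E approx v f h r ∂(roundLaw m S E approx h) ≤ 0 := by
    intro h hh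
    have ha : (actions h).length < T := by rwa [hlen]
    have hη := hpos _ ha.le
    have hη1 := hone _ ha.le
    have hα0 := hα1 (actions h)
    refine ⟨integrable_regretIncrement hS hη hη1 v f,
      integral_abs_regretIncrement_le hS hη hη1 (hE _ ha) v ?_,
      (integral_regretIncrement_le hS hη hη1 (hE _ ha) hSm v f).trans ?_⟩
    · rw [abs_of_nonneg (by positivity)]
      refine mul_le_mul_of_nonneg_left ?_ (by positivity)
      exact (mul_le_of_le_one_left (by linarith) hη1).trans (hαN _)
    · have h1 := sum_playProb_div_resampleRate_le hS hm hSm hN (E.graph (actions h)) hη hη1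
        (lossEstimate E h)
      have h2 : Real.log (1 + (rate m approx (actions h))⁻¹) ≤ 2 * Λ :=
        (Real.log_le_log (by positivity) (by linarith [hinv _ ha])).trans hlogX
      have h3 := mul_le_mul_of_nonneg_left h2 (show 0 ≤ 4 * m * α (actions h) by positivity)
      have h4 := mul_le_mul_of_nonneg_left (h1.trans h3)
        (show 0 ≤ (2 * m + 1) * rate m approx (actions h) by positivity)
      have h5 : (2 * m + 1) * rate m approx (actions h) * (4 * m * α (actions h) * (2 * Λ)) ≤
          3 * m * rate m approx (actions h) * (4 * m * α (actions h) * (2 * Λ)) := by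
        have : (2 * m + 1 : ℝ) ≤ 3 * m := by linarith
        gcongr
      have h6 : f (actions h) =
        3 * m * rate m approx (actions h) * (4 * m * α (actions h) * (2 * Λ)) := by
        rw [hf]; ring
      linarith
  obtain ⟨hF, hF0⟩ := integrable_cumulative hS hD le_rfl
  set W : List (Action N) → ℝ := fun a =>
    Real.sqrt ((N + C * sumPast α a) * (Real.log N + 1)) with hW
  -- The constant 49 is 1 from the pathwise penalty plus 48 = 24 · 2 from summing the compensator,
  -- where m² falls to m^(3/2) through the 1/√m in the parameter.
  have hpath : ∀ h : List (Round N), h.length = T → excessLoss E v (actions h) ≤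
      cumulative (regretIncrement m S E approx v f) h +
        49 * Λ * (m : ℝ) ^ (3 / 2 : ℝ) * W (actions h) := by
    intro h hh
    have ha : (actions h).length ≤ T := by rw [hlen, hh]
    have h1 := cumulative_regretIncrement m S E approx v f h
    have h2 := cumulative_estimatedGap_le hS hSm (fun a ha i => (hE a ha i).1) hpos
      (fun u a ha => rate_cons_le hm hN (hsum0 ha.le) (hap0 a ha) u) hv hh.le
    rw [inv_rate_mul_eq hm hN (hsum0 ha)] at h2
    have hm32 : 0 ≤ (m : ℝ) ^ (3 / 2 : ℝ) := by positivity
    have hA0 : 0 ≤ sumPast α (actions h) :=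
      sumPast_nonneg (T := T) (fun a _ => by linarith [hα1 a]) ha
    have h3 : Real.sqrt ((N + sumPast approx (actions h)) * (Real.log N + 1)) ≤ W (actions h) := by
      refine Real.sqrt_le_sqrt (mul_le_mul_of_nonneg_right ?_ (by positivity))
      have h4 : sumPast approx (actions h) ≤ sumPast α (actions h) :=
        sumPast_le_sumPast (fun a ha => (happrox a ha).2) ha
      nlinarith
    have hW0 : 0 ≤ W (actions h) := Real.sqrt_nonneg _
    have h5 : (m : ℝ) ^ (3 / 2 : ℝ) *
        Real.sqrt ((N + sumPast approx (actions h)) * (Real.log N + 1)) ≤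
        Λ * (m : ℝ) ^ (3 / 2 : ℝ) * W (actions h) := by
      refine (mul_le_mul_of_nonneg_left h3 hm32).trans ?_
      rw [mul_assoc]
      exact le_mul_of_one_le_left (by positivity) hΛ1
    have h6 : sumPast f (actions h) ≤ 48 * Λ * (m : ℝ) ^ (3 / 2 : ℝ) * W (actions h) := by
      rw [hf, sumPast_const_mul]
      have h7 := sumPast_rate_mul_le hm hN hC.le (approx := approx) (α := α)
        (fun a ha => ⟨by linarith [hα1 a], hαN a, hαC a ha⟩) ha
      have h8 : Real.sqrt ((Real.log N + 1) / m * (C * sumPast α (actions h))) ≤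
          W (actions h) / Real.sqrt m := by
        rw [hW, ← Real.sqrt_div (by positivity)]
        refine Real.sqrt_le_sqrt ?_
        rw [div_mul_eq_mul_div, mul_comm]
        gcongr
        linarith
      have hsm : 0 < Real.sqrt m := Real.sqrt_pos.2 (by linarith)
      calc _ ≤ 24 * (m : ℝ) ^ 2 * Λ * (2 * (W (actions h) / Real.sqrt m)) :=
            mul_le_mul_of_nonneg_left (h7.trans (by linarith)) (by positivity)
        _ = _ := by
          rw [natCast_rpow_three_halves]
          have hmm : (m : ℝ) ^ 2 = m * (Real.sqrt m * Real.sqrt m) := by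
            rw [Real.mul_self_sqrt (by linarith), sq]
          rw [hmm]
          field_simp
          ring
    linarith
  have hWi := (integrable_comp_actions (m := m) (E := E) (approx := approx) hS W T).const_mul
    (49 * Λ * (m : ℝ) ^ (3 / 2 : ℝ))
  have hlast : ∫ h, excessLoss E v (actions h) ∂(historyLaw m S E approx T) ≤
      ∫ h, (cumulative (regretIncrement m S E approx v f) h +
        49 * Λ * (m : ℝ) ^ (3 / 2 : ℝ) * W (actions h)) ∂(historyLaw m S E approx T) := by
    refine integral_mono_ae (integrable_comp_actions hS _ T) (hF.add hWi) ?_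
    filter_upwards [ae_length_historyLaw (m := m) (S := S) (E := E) (approx := approx) T]
      with h hh using hpath h hh
  rw [integral_add hF hWi, integral_const_mul] at hlast
  linarith

end Regret

end FPLIX

/-! ### The theorem -/

theorem mainTheorem12 :
    ∃ H : ℕ → ℕ → ℕ → ℝ,
      (∃ c : ℝ, ∀ N m T : ℕ, 1 ≤ m → 1 ≤ T → 4 < m * N →
        |H N m T| ≤ c * Real.log ((m : ℝ) * N * T)) ∧
      ∀ (N m T : ℕ), 1 ≤ m → 1 ≤ T → 4 < m * N →
      ∀ (S : Finset (FPLIX.Action N)) (hS : S.Nonempty), (∀ v ∈ S, v.card ≤ m) →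
      ∀ (E : FPLIX.Environment N) (approx : List (FPLIX.Action N) → ℝ) (C : ℝ), 1 < C →
        (∀ a : List (FPLIX.Action N), a.length < T → ∀ i, E.loss a i ∈ Set.Icc (0 : ℝ) 1) →
        (∀ a : List (FPLIX.Action N), a.length < T →
          (FPLIX.indepNumber (E.graph a) : ℝ) / C ≤ approx a ∧
            approx a ≤ FPLIX.indepNumber (E.graph a)) →
        FPLIX.regret m S hS E approx T ≤
            H N m T * (m : ℝ) ^ (3 / 2 : ℝ) *
              ∫ h, Real.sqrt ((N + C * FPLIX.sumPast
                    (fun a => (FPLIX.indepNumber (E.graph a) : ℝ)) (FPLIX.actions h)) *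
                  (Real.log N + 1)) ∂(FPLIX.historyLaw m S E approx T) ∧
          ∀ α : ℕ → ℕ,
            (∀ a : List (FPLIX.Action N), a.length < T →
              FPLIX.indepNumber (E.graph a) = α (a.length + 1)) →
            FPLIX.regret m S hS E approx T ≤
              H N m T * (m : ℝ) ^ (3 / 2 : ℝ) *
                Real.sqrt ((N + C * ∑ t ∈ Finset.Icc 1 T, (α t : ℝ)) * (Real.log N + 1)) := by
  refine ⟨fun N m T => 49 * Real.log ((m : ℝ) * N * T), ⟨49, fun N m T hm hT hmN => ?_⟩, ?_⟩
  · have h1 : (1 : ℝ) ≤ (m : ℝ) * N * T := by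
      have : 1 ≤ m * N * T := Nat.mul_pos (by omega) hT
      exact_mod_cast this
    rw [abs_of_nonneg (mul_nonneg (by norm_num) (Real.log_nonneg h1))]
  intro N m T hm hT hmN S hS hSm E approx C hC hE happrox
  have hmain : FPLIX.regret m S hS E approx T ≤
      49 * Real.log ((m : ℝ) * N * T) * (m : ℝ) ^ (3 / 2 : ℝ) *
        ∫ h, Real.sqrt ((N + C * FPLIX.sumPast
          (fun a => (FPLIX.indepNumber (E.graph a) : ℝ)) (FPLIX.actions h)) *
          (Real.log N + 1)) ∂(FPLIX.historyLaw m S E approx T) :=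
    Finset.sup'_le _ _ fun v hv =>
      FPLIX.integral_excessLoss_le hm hT hmN hS hSm hC hE happrox hv
  -- When the independence numbers do not depend on the actions, the square root is almost surely
  -- constant, as histories have length `T` almost surely.
  refine ⟨hmain, fun α hα => hmain.trans (le_of_eq ?_)⟩
  have hpr := FPLIX.isProbabilityMeasure_historyLaw (m := m) (E := E) (approx := approx) hS T
  congr 1
  rw [MeasureTheory.integral_congr_ae (g := fun _ =>
    Real.sqrt ((N + C * ∑ t ∈ Finset.Icc 1 T, (α t : ℝ)) * (Real.log N + 1)))]
  · simp
  · filter_upwards [FPLIX.ae_length_historyLaw (m := m) (S := S) (E := E) (approx := approx) T]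
      with h hh
    have hlen : (FPLIX.actions h).length = T := (List.length_map _).trans hh
    have e := FPLIX.sumPast_eq_sum_Icc (f := fun a => (FPLIX.indepNumber (E.graph a) : ℝ))
      (α := fun t => (α t : ℝ)) (T := T) (fun a ha => by rw [hα a ha]) hlen.le
    rw [e, hlen]
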